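/- Let $X$ be a real Banach space, let $d\ge 1$, and let $q:X\to[0,\infty)$ be a continuous $2d$-homogeneous polynomial with $\|x\|^{2d}\le q(x)$ for all $x\in X$. Put $Q(x)=(1+q(x))^{1/(2d)}-1$, let $\mathrm{Lip}(Q)$ be its Lipschitz constant, and let $D_Q(x,r)=\{y\in X: Q(y-x)<r\}$. Let $\widetilde X=X\oplus iX$ be the Taylor complexification, with norm $\|x+iy\|_{\widetilde X}=\sup_{\theta}\|\cos\theta\,x-\sin\theta\,y\|$, and for $\delta>0$ let $W_\delta=\{x+z: x\in X,\ z\in\widetilde X,\ \|z\|_{\widetilde X}<\delta\}$. There is $\delta_Q>0$ such that $Q$ has a holomorphic extension $\widetilde Q:W_{\delta_Q}\to\mathbb C$ that is Lipschitz on $W_{\delta_Q}$. Moreover, let $\delta_Q>0$ be any number with this property, let $K,\eta>0$, and let $(x_n)_{n\ge 1}$ be a sequence in $X$. Call $r>0$ admissible if $X=\bigcup_{j=1}^\infty D_Q(x_j,r)$. Then there are holomorphic functions $\widetilde\varphi_{n,r,\varepsilon}:W_{\delta_Q}\to\mathbb C$ ($n\ge 1$, $r$ admissible, $\varepsilon\in(0,1)$),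 real-valued on $X$ with restrictions $\varphi_{n,r,\varepsilon}$ to $X$, and there are positive integers $m_{x,r},n_{x,r}$ and numbers $a_{x,r}>0$, $0<\delta_{x,r}\le\delta_Q$ (all independent of $\varepsilon$), positive integers $n_{x,r,\varepsilon}$ and numbers $0<\delta_{x,r,\varepsilon}<\delta_Q$ (for $x\in X$), such that for all admissible $r$ and all $\varepsilon\in(0,1)$: (1) each $\varphi_{n,r,\varepsilon}$ maps $X$ into $[0,2]$ and is Lipschitz with constant $2\,\mathrm{Lip}(Q)/r$; (2) $0\le\varphi_{n,r,\varepsilon}(x)\le 1+\varepsilon$ for all $x\in X$ and all $n$; (3) $\varphi_{m_{x,r},r,\varepsilon}(x)>1$ for each $x\in X$; and $m_{x,s}\ge m_{x,r}$ for all $x\in X$ and all admissible $s\le r$; (4) $0\le\varphi_{n,r,\varepsilon}(x)\le\varepsilon$ for all $n$ and all $x\in X\setminus D_Q(x_n,4r)$; (4') $|\varphi_{n,r,\varepsilon}(x)|\le\varepsilon$, $\varphi_{n,r,\varepsilon}$ is differentiable at $x$, and $\|\varphi_{n,r,\varepsilon}'(x)\|\le\varepsilon$, for all $n$ and all $x\in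 X\setminus D_Q(x_n,5r)$; (5) for each $x\in X$, $n>n_{x,r}$ and $z\in\widetilde X$ with $\|z\|_{\widetilde X}<\delta_{x,r}$, $$|\widetilde\varphi_{n,r,\varepsilon}(x+z)|<\frac{1}{n!\,a_{x,r}^{\,n}\,M_n},\qquad M_n:=e^{2K^2\eta}(1+\|x_n\|);$$ (6) for each $x\in X$, $n>n_{x,r,\varepsilon}$ and $z\in\widetilde X$ with $\|z\|_{\widetilde X}<\delta_{x,r}$, $|\widetilde\varphi_{n,r,\varepsilon}(x+z)|<\varepsilon$; (7) if $r\ge 1$, then for each $x\in X$, all $n\ge 1$ and all $z\in\widetilde X$ with $\|z\|_{\widetilde X}\le\delta_{x,r,\varepsilon}$, $|\widetilde\varphi_{n,r,\varepsilon}(x+z)|\le 1+2\varepsilon$. Finally, on the admissible $r\ge 1$, the numbers $\delta_{x,r},a_{x,r},n_{x,r},\delta_{x,r,\varepsilon},n_{x,r,\varepsilon}$ do not depend on $r$. -/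

import Mathlib

/-- The underlying space `X ⊕ iX` of the Taylor complexification of a real normed space `X`;
the element `⟨x, y⟩` is `x + iy`. -/
@[ext]
structure TaylorComplexification (X : Type*) where
  re : X
  im : X

namespace TaylorComplexification

section Algebra

variable {X : Type*} [NormedAddCommGroup X]

/-- `x + iy ↦ (x, y)`. -/
def equivProd (X : Type*) : TaylorComplexification X ≃ X × X where
  toFun z := (z.re, z.im)
  invFun p := ⟨p.1, p.2⟩
  left_inv _ := rfl
  right_inv _ := rfl

instance : AddCommGroup (TaylorComplexification X) := (equivProd X).addCommGroup

@[simp] theorem zero_re : (0 : TaylorComplexification X).re = 0 := rfl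
@[simp] theorem zero_im : (0 : TaylorComplexification X).im = 0 := rfl
@[simp] theorem add_re (z w : TaylorComplexification X) : (z + w).re = z.re + w.re := rfl
@[simp] theorem add_im (z w : TaylorComplexification X) : (z + w).im = z.im + w.im := rfl

variable [NormedSpace ℝ X]

/-- `(a + ib)(x + iy) = (ax - by) + i(ay + bx)`. -/
instance : SMul ℂ (TaylorComplexification X) where
  smul c z := ⟨c.re • z.re - c.im • z.im, c.re • z.im + c.im • z.re⟩

@[simp] theorem smul_re (c : ℂ) (z : TaylorComplexification X) :
    (c • z).re = c.re • z.re - c.im • z.im := rfl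
@[simp] theorem smul_im (c : ℂ) (z : TaylorComplexification X) :
    (c • z).im = c.re • z.im + c.im • z.re := rfl

instance : Module ℂ (TaylorComplexification X) where
  one_smul z := by ext <;> simp
  mul_smul c d z := by
    ext
    · simp only [smul_re, smul_im, Complex.mul_re, Complex.mul_im]; module
    · simp only [smul_re, smul_im, Complex.mul_re, Complex.mul_im]; module
  smul_zero c := by ext <;> simp
  smul_add c z w := by
    ext
    · simp only [smul_re, add_re, add_im]; module
    · simp only [smul_im, add_re, add_im]; module
  add_smul c d z := by
    ext
    · simp only [smul_re, add_re, Complex.add_re, Complex.add_im]; module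
    · simp only [smul_im, add_im, Complex.add_re, Complex.add_im]; module
  zero_smul z := by ext <;> simp

/-- The Taylor norm `‖x + iy‖ = sup_θ ‖cos θ x - sin θ y‖`
(by periodicity, the supremum over `θ ∈ [0, 2π]` is the supremum over all real `θ`). -/
noncomputable instance : Norm (TaylorComplexification X) where
  norm z := ⨆ θ : ℝ, ‖Real.cos θ • z.re - Real.sin θ • z.im‖

theorem norm_def (z : TaylorComplexification X) :
    ‖z‖ = ⨆ θ : ℝ, ‖Real.cos θ • z.re - Real.sin θ • z.im‖ := rfl

theorem bddAbove_norm (z : TaylorComplexification X) :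
    BddAbove (Set.range fun θ : ℝ => ‖Real.cos θ • z.re - Real.sin θ • z.im‖) := by
  refine ⟨‖z.re‖ + ‖z.im‖, ?_⟩
  rintro _ ⟨θ, rfl⟩
  refine (norm_sub_le _ _).trans (add_le_add ?_ ?_)
  · rw [norm_smul]
    exact mul_le_of_le_one_left (norm_nonneg _) (Real.abs_cos_le_one θ)
  · rw [norm_smul]
    exact mul_le_of_le_one_left (norm_nonneg _) (Real.abs_sin_le_one θ)

theorem le_norm (z : TaylorComplexification X) (θ : ℝ) :
    ‖Real.cos θ • z.re - Real.sin θ • z.im‖ ≤ ‖z‖ :=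
  le_ciSup (bddAbove_norm z) θ

theorem norm_smul_le (c : ℂ) (z : TaylorComplexification X) : ‖c • z‖ ≤ ‖c‖ * ‖z‖ := by
  rw [norm_def (c • z)]
  refine ciSup_le fun θ => ?_
  have h : Real.cos θ • (c • z).re - Real.sin θ • (c • z).im =
      ‖c‖ • (Real.cos (θ + c.arg) • z.re - Real.sin (θ + c.arg) • z.im) := by
    rw [smul_re, smul_im, Real.cos_add, Real.sin_add]
    have h1 : c.re = ‖c‖ * Real.cos c.arg := (Complex.norm_mul_cos_arg c).symm
    have h2 : c.im = ‖c‖ * Real.sin c.arg := (Complex.norm_mul_sin_arg c).symm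
    generalize Real.cos c.arg = u at *
    generalize Real.sin c.arg = v at *
    rw [h1, h2]
    module
  rw [h, norm_smul, Real.norm_of_nonneg (norm_nonneg c)]
  exact mul_le_mul_of_nonneg_left (le_norm z _) (norm_nonneg c)

theorem normCore : NormedSpace.Core ℂ (TaylorComplexification X) where
  norm_nonneg z := Real.iSup_nonneg fun _ => norm_nonneg _
  norm_smul c z := by
    refine le_antisymm (norm_smul_le c z) ?_
    by_cases hc : c = 0
    · have : 0 ≤ ‖c • z‖ := Real.iSup_nonneg fun _ => norm_nonneg _
      simpa [hc] using this
    · have h := norm_smul_le c⁻¹ (c • z)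
      rw [smul_smul, inv_mul_cancel₀ hc, one_smul, norm_inv] at h
      rwa [← le_inv_mul_iff₀ (norm_pos_iff.mpr hc)]
  norm_triangle z w := by
    rw [norm_def (z + w)]
    refine ciSup_le fun θ => ?_
    have h : Real.cos θ • (z + w).re - Real.sin θ • (z + w).im =
        (Real.cos θ • z.re - Real.sin θ • z.im) + (Real.cos θ • w.re - Real.sin θ • w.im) := by
      simp only [add_re, add_im]; module
    rw [h]
    exact (norm_add_le _ _).trans (add_le_add (le_norm z θ) (le_norm w θ))
  norm_eq_zero_iff z := by
    constructor
    · intro h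
      have h0 := le_norm z 0
      have h1 := le_norm z (Real.pi / 2)
      rw [h] at h0 h1
      ext
      · simpa using h0
      · simpa using h1
    · rintro rfl
      simp [norm_def]

noncomputable instance : NormedAddCommGroup (TaylorComplexification X) :=
  NormedAddCommGroup.ofCore (𝕜 := ℂ) normCore

noncomputable instance : NormedSpace ℂ (TaylorComplexification X) :=
  NormedSpace.ofCore normCore

/-- The canonical embedding `x ↦ x + i0` of `X` into its complexification. -/
def ofReal (x : X) : TaylorComplexification X := ⟨x, 0⟩

variable (X) in
/-- The open strip `W_δ = {x + z : x ∈ X, z ∈ X̃, ‖z‖ < δ}` around `X`. -/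
def strip (δ : ℝ) : Set (TaylorComplexification X) :=
  {w | ∃ (x : X) (z : TaylorComplexification X), ‖z‖ < δ ∧ w = ofReal x + z}

end Algebra

end TaylorComplexification

section SeparatingFunctions

variable {X : Type*} [NormedAddCommGroup X] [NormedSpace ℝ X]

/-- `q` is a (continuous) `k`-homogeneous polynomial: the restriction to the diagonal of a
continuous `k`-linear form. -/
def IsHomogeneousPolynomial (k : ℕ) (q : X → ℝ) : Prop :=
  ∃ A : ContinuousMultilinearMap ℝ (fun _ : Fin k => X) ℝ, ∀ x, q x = A fun _ => x

/-- The function `Q(x) = (1 + q(x))^{1/(2d)} - 1` associated with a `2d`-homogeneous polynomial. -/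
noncomputable def separatingFun (d : ℕ) (q : X → ℝ) (x : X) : ℝ :=
  (1 + q x) ^ (1 / (2 * (d : ℝ))) - 1

/-- The `Q`-body `D_Q(x, r) = {y : Q(y - x) < r}`. -/
def QBody (Q : X → ℝ) (x : X) (r : ℝ) : Set X := {y | Q (y - x) < r}

/-- The `Q`-bodies of radius `r` centred at the points of the sequence `p` cover the space. -/
def CoversAtRadius (Q : X → ℝ) (p : ℕ+ → X) (r : ℝ) : Prop :=
  ⋃ j, QBody Q (p j) r = Set.univ

/-- The Lipschitz constant `Lip(f)`: the least `C` such that `f` is `C`-Lipschitz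
(used for Lipschitz functions only). -/
noncomputable def lipConst (f : X → ℝ) : ℝ :=
  ((sInf {C : NNReal | LipschitzWith C f} : NNReal) : ℝ)

/-- `Qt` is a Lipschitz holomorphic extension of `Q : X → ℝ` to the open strip `W_δ`, `δ > 0`.
(Only the values of `Qt` on the strip matter.) -/
structure IsLipschitzHolomorphicExtension (Q : X → ℝ) (δ : ℝ)
    (Qt : TaylorComplexification X → ℂ) : Prop where
  pos : 0 < δ
  extends_real : ∀ x, Qt (TaylorComplexification.ofReal x) = (Q x : ℂ)
  holomorphic : DifferentiableOn ℂ Qt (TaylorComplexification.strip X δ)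
  lipschitz : ∃ C : NNReal, LipschitzOnWith C Qt (TaylorComplexification.strip X δ)

end SeparatingFunctions

/-! Put y_j = Q(x - x_j)/r. The model for the n-th function is the minimum of 1 + ε, of 2(y_j -
3/2)⁺ for j < n, and of 2(15/4 - y_n)⁺. As a layer-cake integral it is ∫ over t in [0, 1 + ε] of the
product of the Heaviside functions of y_j - 3/2 - t/2, j < n, and of 15/4 - t/2 - y_n. Replacing the
Heaviside functions by Gaussian distribution functions with slopes b_j = k 2^{-j} makes it entire in
the y_j; substituting Q̃(· - x_j)/r for y_j gives a holomorphic function on the strip.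

Since t enters every factor through -t/2, a change of all y_j by at most h is dominated by a
translation of t by 2h. Hence the Lipschitz constant is 2 Lip(Q)/r whatever the slopes
(`sepFunReal_le_add`). The function exceeds 1 at the first index m with y_m < 21/8
(`le_sepFunReal`), and its last factor makes it small where y_n ≥ 4.

For the decay in n, take i with y_i ≤ 5/4 and put β = k 2^{-i}. For n > i the i-th factor
contributes at most exp(-β²/64). If all imaginary parts are at most 1/(16·2^i), leaving the real
axis costs at most exp(β²/256), because the b_j² sum to at most k². This width does not involve k,
so k can be chosen afterwards, separately for each n and ε, to beat any prescribed bound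
(`norm_sepFun_le_tail`, `exists_scale`). Thus a = 1 suffices and δ is independent of ε.

For the existence of Q̃, q is complexified. On a thin strip q̃ differs from q(x) by at most (1 +
‖x‖^{2d})/2, so 1 + q̃ stays in the right half-plane and the principal root is holomorphic. Its
derivative is bounded because the growth of q̃', of degree 2d - 1, is cancelled by the power 1/(2d)
- 1. -/

section

open MeasureTheory Set

/-! ### The Gaussian distribution function as an entire smooth step. -/

/-- The entire function `ζ ↦ π^{-1/2} ∫_{-∞}^0 exp(-(s + ζ)²) ds`, which on the real axis is the
distribution function of the Gaussian density `π^{-1/2} exp(-s²)`. -/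
noncomputable def gaussCdf (ζ : ℂ) : ℂ :=
  ((√Real.pi)⁻¹ : ℝ) * ∫ s : ℝ in Iic 0, Complex.exp (-((s : ℂ) + ζ) ^ 2)

/-- The restriction of `gaussCdf` to the real axis. -/
noncomputable def gaussCdfReal (u : ℝ) : ℝ :=
  (√Real.pi)⁻¹ * ∫ s in Iic 0, Real.exp (-(s + u) ^ 2)

theorem gaussCdf_ofReal (u : ℝ) : gaussCdf u = gaussCdfReal u := by
  unfold gaussCdf gaussCdfReal
  rw [Complex.ofReal_mul, ← integral_complex_ofReal]
  simp

theorem integrable_exp_neg_sq : Integrable fun s : ℝ => Real.exp (-s ^ 2) := by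
  simpa using integrable_exp_neg_mul_sq (b := 1) one_pos

theorem integral_exp_neg_sq : ∫ s : ℝ, Real.exp (-s ^ 2) = √Real.pi := by
  simpa using integral_gaussian 1

theorem integrable_exp_neg_add_sq (u : ℝ) : Integrable fun s : ℝ => Real.exp (-(s + u) ^ 2) :=
  integrable_exp_neg_sq.comp_add_right u

theorem gaussCdfReal_eq (u : ℝ) :
    gaussCdfReal u = (√Real.pi)⁻¹ * ∫ s in Iic u, Real.exp (-s ^ 2) := by
  unfold gaussCdfReal
  congr 1
  have := (measurePreserving_add_right volume u).setIntegral_preimage_emb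
    (measurableEmbedding_addRight u) (fun s : ℝ => Real.exp (-s ^ 2)) (Iic u)
  rw [← this]
  congr 2
  ext s
  simp

theorem gaussCdfReal_nonneg (u : ℝ) : 0 ≤ gaussCdfReal u :=
  mul_nonneg (by positivity) (integral_nonneg fun _ => (Real.exp_pos _).le)

theorem gaussCdfReal_mono : Monotone gaussCdfReal := by
  intro u v huv
  rw [gaussCdfReal_eq, gaussCdfReal_eq]
  refine mul_le_mul_of_nonneg_left ?_ (by positivity)
  exact setIntegral_mono_set integrable_exp_neg_sq.integrableOn
    (Filter.Eventually.of_forall fun _ => (Real.exp_pos _).le) (Iic_subset_Iic.2 huv).eventuallyLE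

theorem gaussCdfReal_add_neg (u : ℝ) : gaussCdfReal u + gaussCdfReal (-u) = 1 := by
  have h : ∫ s in Iic (-u), Real.exp (-s ^ 2) = ∫ s in Ioi u, Real.exp (-s ^ 2) := by
    have := integral_comp_neg_Iic (-u) (fun s : ℝ => Real.exp (-s ^ 2))
    simpa using this
  rw [gaussCdfReal_eq, gaussCdfReal_eq, h, ← mul_add,
    intervalIntegral.integral_Iic_add_Ioi (b := u) integrable_exp_neg_sq.integrableOn
      integrable_exp_neg_sq.integrableOn, integral_exp_neg_sq]
  exact inv_mul_cancel₀ (by positivity)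

theorem gaussCdfReal_le_one (u : ℝ) : gaussCdfReal u ≤ 1 := by
  linarith [gaussCdfReal_add_neg u, gaussCdfReal_nonneg (-u)]

/-- For t ≤ 0 ≤ s one has (t - s)² ≥ t² + s², so exp(-s²) can be pulled out of the integral. -/
theorem gaussCdfReal_neg_le {s : ℝ} (hs : 0 ≤ s) : gaussCdfReal (-s) ≤ Real.exp (-s ^ 2) := by
  have h : gaussCdfReal (-s) ≤ Real.exp (-s ^ 2) * gaussCdfReal 0 := by
    unfold gaussCdfReal
    rw [mul_left_comm, ← integral_const_mul (Real.exp (-s ^ 2))]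
    refine mul_le_mul_of_nonneg_left ?_ (by positivity)
    refine setIntegral_mono_on (integrable_exp_neg_add_sq _).integrableOn
      ((integrable_exp_neg_add_sq 0).const_mul _).integrableOn measurableSet_Iic ?_
    intro t ht
    rw [← Real.exp_add, Real.exp_le_exp]
    have : t * s ≤ 0 := mul_nonpos_of_nonpos_of_nonneg ht hs
    nlinarith
  exact h.trans (mul_le_of_le_one_right (Real.exp_pos _).le (gaussCdfReal_le_one 0))

theorem one_sub_le_gaussCdfReal {s : ℝ} (hs : 0 ≤ s) :
    1 - Real.exp (-s ^ 2) ≤ gaussCdfReal s := by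
  linarith [gaussCdfReal_add_neg s, gaussCdfReal_neg_le hs]

theorem norm_exp_neg_add_sq (s : ℝ) (ζ : ℂ) : ‖Complex.exp (-((s : ℂ) + ζ) ^ 2)‖ =
    Real.exp (ζ.im ^ 2) * Real.exp (-(s + ζ.re) ^ 2) := by
  rw [Complex.norm_exp, ← Real.exp_add]
  congr 1
  simp [sq]
  ring

theorem norm_gaussCdf_le (ζ : ℂ) : ‖gaussCdf ζ‖ ≤ Real.exp (ζ.im ^ 2) * gaussCdfReal ζ.re := by
  unfold gaussCdf gaussCdfReal
  rw [norm_mul, Complex.norm_real, Real.norm_of_nonneg (by positivity), mul_left_comm,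
    ← integral_const_mul]
  refine mul_le_mul_of_nonneg_left ?_ (by positivity)
  refine (norm_integral_le_integral_norm _).trans_eq ?_
  simp_rw [norm_exp_neg_add_sq]

theorem differentiable_gaussCdf : Differentiable ℂ gaussCdf := by
  intro ζ₀
  unfold gaussCdf
  refine DifferentiableAt.const_mul ?_ _
  set R := ‖ζ₀‖ + 1
  have hmeas (ζ : ℂ) : AEStronglyMeasurable (fun s : ℝ => Complex.exp (-((s : ℂ) + ζ) ^ 2))
      (volume.restrict (Iic 0)) := by
    apply Continuous.aestronglyMeasurable
    fun_prop
  have key := hasDerivAt_integral_of_dominated_loc_of_deriv_le (𝕜 := ℂ)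
    (μ := volume.restrict (Iic (0 : ℝ)))
    (F := fun (ζ : ℂ) (s : ℝ) => Complex.exp (-((s : ℂ) + ζ) ^ 2))
    (F' := fun (ζ : ℂ) (s : ℝ) => Complex.exp (-((s : ℂ) + ζ) ^ 2) * (-(2 * ((s : ℂ) + ζ))))
    (x₀ := ζ₀) (s := Metric.ball ζ₀ 1)
    -- The bound rests on (s + Re ζ)² ≥ s²/2 - (Re ζ)², which leaves the integrable Gaussian
    -- exp(-s²/2) uniformly for ‖ζ‖ ≤ R.
    (bound := fun s => Real.exp (2 * R ^ 2) * (2 * |s * Real.exp (-(1 / 2) * s ^ 2)| +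
      2 * R * Real.exp (-(1 / 2) * s ^ 2)))
    (Metric.ball_mem_nhds _ one_pos) (Filter.Eventually.of_forall hmeas) ?_ ?_ ?_ ?_ ?_
  · exact key.2.differentiableAt
  · refine (((integrable_exp_neg_add_sq ζ₀.re).const_mul
      (Real.exp (ζ₀.im ^ 2))).restrict (s := Iic 0)).mono' (hmeas _) ?_
    exact Filter.Eventually.of_forall fun s => (norm_exp_neg_add_sq s ζ₀).le
  · apply Continuous.aestronglyMeasurable
    fun_prop
  · refine Filter.Eventually.of_forall fun s ζ hζ => ?_
    have hR : ‖ζ‖ ≤ R := by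
      have := norm_le_norm_add_norm_sub' ζ ζ₀
      have h2 : ‖ζ - ζ₀‖ < 1 := by simpa [dist_eq_norm] using hζ
      linarith
    have hre : |ζ.re| ≤ R := (Complex.abs_re_le_norm ζ).trans hR
    have him : |ζ.im| ≤ R := (Complex.abs_im_le_norm ζ).trans hR
    have hre2 := sq_le_sq' (neg_le_of_abs_le hre) (le_of_abs_le hre)
    have him2 := sq_le_sq' (neg_le_of_abs_le him) (le_of_abs_le him)
    rw [norm_mul, norm_exp_neg_add_sq, norm_neg, norm_mul, abs_mul, abs_of_pos (Real.exp_pos _),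
      ← Real.exp_add]
    have h1 : Real.exp (ζ.im ^ 2 + -(s + ζ.re) ^ 2) ≤
        Real.exp (2 * R ^ 2) * Real.exp (-(1 / 2) * s ^ 2) := by
      rw [← Real.exp_add, Real.exp_le_exp]
      nlinarith [sq_nonneg (s + 2 * ζ.re)]
    have h2 : ‖(2 : ℂ)‖ * ‖(s : ℂ) + ζ‖ ≤ 2 * (|s| + R) := by
      have := norm_add_le (s : ℂ) ζ
      rw [Complex.norm_real, Real.norm_eq_abs] at this
      rw [Complex.norm_two]
      linarith
    refine (mul_le_mul h1 h2 (by positivity) (by positivity)).trans_eq ?_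
    ring
  · have h1 : Integrable fun s : ℝ => s * Real.exp (-(1 / 2) * s ^ 2) :=
      integrable_mul_exp_neg_mul_sq (by norm_num)
    have h2 : Integrable fun s : ℝ => Real.exp (-(1 / 2) * s ^ 2) :=
      integrable_exp_neg_mul_sq (by norm_num)
    exact (((h1.abs.const_mul 2).add (h2.const_mul (2 * R))).const_mul _).restrict
  · refine Filter.Eventually.of_forall fun s ζ _ => ?_
    have h := ((((hasDerivAt_id ζ).const_add (s : ℂ)).pow 2).neg).cexp
    simpa using h

theorem continuous_gaussCdfReal : Continuous gaussCdfReal := by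
  have : gaussCdfReal = fun u : ℝ => (gaussCdf u).re := by
    ext u
    rw [gaussCdf_ofReal, Complex.ofReal_re]
  rw [this]
  exact Complex.continuous_re.comp (differentiable_gaussCdf.continuous.comp
    Complex.continuous_ofReal)

/-! ### The smoothed minimum and its real estimates. -/

/-- The integrand of `sepFun`. -/
noncomputable def sepKernel (b : ℕ+ → ℝ) (n : ℕ+) (w : ℕ+ → ℂ) (t : ℂ) : ℂ :=
  (∏ j ∈ Finset.Ico 1 n, gaussCdf (b j * (w j - 3 / 2 - t / 2))) *
    gaussCdf (b n * (15 / 4 - t / 2 - w n))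

/-- The integrand of `sepFunReal`. -/
noncomputable def sepKernelReal (b : ℕ+ → ℝ) (n : ℕ+) (y : ℕ+ → ℝ) (t : ℝ) : ℝ :=
  (∏ j ∈ Finset.Ico 1 n, gaussCdfReal (b j * (y j - 3 / 2 - t / 2))) *
    gaussCdfReal (b n * (15 / 4 - t / 2 - y n))

/-- An entire function of `w 1, …, w n` which on real arguments is a smooth approximation of the
function that is large where `w n` is small and all `w j`, `j < n`, are large. -/
noncomputable def sepFun (b : ℕ+ → ℝ) (T : ℝ) (n : ℕ+) (w : ℕ+ → ℂ) : ℂ :=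
  ∫ t in (0 : ℝ)..T, sepKernel b n w t

/-- The restriction of `sepFun` to real arguments. -/
noncomputable def sepFunReal (b : ℕ+ → ℝ) (T : ℝ) (n : ℕ+) (y : ℕ+ → ℝ) : ℝ :=
  ∫ t in (0 : ℝ)..T, sepKernelReal b n y t

section RealEstimates

variable {b : ℕ+ → ℝ} {T : ℝ} {n : ℕ+} {y y' : ℕ+ → ℝ}

theorem sepKernel_ofReal (t : ℝ) :
    sepKernel b n (fun j => (y j : ℂ)) t = sepKernelReal b n y t := by
  unfold sepKernel sepKernelReal
  push_cast
  simp_rw [← gaussCdf_ofReal]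
  push_cast
  rfl

theorem sepFun_ofReal : sepFun b T n (fun j => (y j : ℂ)) = sepFunReal b T n y := by
  unfold sepFun sepFunReal
  rw [← intervalIntegral.integral_ofReal]
  simp_rw [sepKernel_ofReal]

theorem continuous_sepKernelReal : Continuous (sepKernelReal b n y) := by
  have := continuous_gaussCdfReal
  unfold sepKernelReal
  fun_prop

theorem sepKernelReal_nonneg (t : ℝ) : 0 ≤ sepKernelReal b n y t :=
  mul_nonneg (Finset.prod_nonneg fun _ _ => gaussCdfReal_nonneg _) (gaussCdfReal_nonneg _)

theorem sepKernelReal_le_last (t : ℝ) :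
    sepKernelReal b n y t ≤ gaussCdfReal (b n * (15 / 4 - t / 2 - y n)) :=
  mul_le_of_le_one_left (gaussCdfReal_nonneg _)
    (Finset.prod_le_one (fun _ _ => gaussCdfReal_nonneg _) fun _ _ => gaussCdfReal_le_one _)

theorem sepKernelReal_le_of_lt {j : ℕ+} (hj : j < n) (t : ℝ) :
    sepKernelReal b n y t ≤ gaussCdfReal (b j * (y j - 3 / 2 - t / 2)) := by
  unfold sepKernelReal
  rw [← Finset.mul_prod_erase _ _ (Finset.mem_Ico.2 ⟨one_le, hj⟩), mul_assoc]
  refine mul_le_of_le_one_right (gaussCdfReal_nonneg _) (mul_le_one₀ ?_ (gaussCdfReal_nonneg _)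
    (gaussCdfReal_le_one _))
  exact Finset.prod_le_one (fun _ _ => gaussCdfReal_nonneg _) fun _ _ => gaussCdfReal_le_one _

theorem sepFunReal_nonneg (hT : 0 ≤ T) : 0 ≤ sepFunReal b T n y :=
  intervalIntegral.integral_nonneg hT fun _ _ => sepKernelReal_nonneg _

theorem intervalIntegral_le_mul_of_le {f : ℝ → ℝ} (hf : Continuous f) {u v C : ℝ} (huv : u ≤ v)
    (h : ∀ t ∈ Icc u v, f t ≤ C) : ∫ t in u..v, f t ≤ (v - u) * C := by
  have := intervalIntegral.integral_mono_on (μ := volume) huv (hf.intervalIntegrable _ _)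
    (intervalIntegrable_const (c := C)) h
  simpa using this

theorem sepFunReal_le (hT : 0 ≤ T) : sepFunReal b T n y ≤ T := by
  have := intervalIntegral_le_mul_of_le (continuous_sepKernelReal (b := b) (n := n) (y := y)) hT
    fun t _ => (sepKernelReal_le_last t).trans (gaussCdfReal_le_one _)
  simpa [sepFunReal] using this

theorem sepFunReal_le_last (hT : 0 ≤ T) (hb : 0 ≤ b n) :
    sepFunReal b T n y ≤ T * gaussCdfReal (b n * (15 / 4 - y n)) := by
  have := intervalIntegral_le_mul_of_le (continuous_sepKernelReal (b := b) (n := n) (y := y)) hT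
    fun t ht => (sepKernelReal_le_last t).trans (gaussCdfReal_mono
      (mul_le_mul_of_nonneg_left (by linarith [ht.1] : _ ≤ 15 / 4 - y n) hb))
  simpa [sepFunReal] using this

theorem sepFunReal_le_of_lt (hT : 0 ≤ T) {j : ℕ+} (hj : j < n) (hb : 0 ≤ b j) :
    sepFunReal b T n y ≤ T * gaussCdfReal (b j * (y j - 3 / 2)) := by
  have := intervalIntegral_le_mul_of_le (continuous_sepKernelReal (b := b) (n := n) (y := y)) hT
    fun t ht => (sepKernelReal_le_of_lt hj t).trans (gaussCdfReal_mono
      (mul_le_mul_of_nonneg_left (by linarith [ht.1] : _ ≤ y j - 3 / 2) hb))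
  simpa [sepFunReal] using this

/-- Lowering t by 2h raises the argument of the j-th factor by b_j h, which absorbs the change in
y_j. This is why t has the same coefficient in all factors. -/
theorem sepKernelReal_le_shift (hb : ∀ j, 0 ≤ b j) {h : ℝ} (hy : ∀ j, |y' j - y j| ≤ h) (t : ℝ) :
    sepKernelReal b n y' t ≤ sepKernelReal b n y (t - 2 * h) := by
  refine mul_le_mul (Finset.prod_le_prod (fun _ _ => gaussCdfReal_nonneg _) fun j _ => ?_) ?_
    (gaussCdfReal_nonneg _) (Finset.prod_nonneg fun _ _ => gaussCdfReal_nonneg _)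
  · refine gaussCdfReal_mono (mul_le_mul_of_nonneg_left ?_ (hb j))
    linarith [(abs_le.1 (hy j)).2]
  · refine gaussCdfReal_mono (mul_le_mul_of_nonneg_left ?_ (hb n))
    linarith [(abs_le.1 (hy n)).1]

/-- After the translation the only excess is the integral over [-2h, 0], where the last factor is at
most its value at t = -2h. Keeping that value instead of 1 is what later makes the derivative small
far from x_n. -/
theorem sepFunReal_le_add (hb : ∀ j, 0 ≤ b j) (hT : 0 ≤ T) {h : ℝ}
    (hy : ∀ j, |y' j - y j| ≤ h) :
    sepFunReal b T n y' ≤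
      sepFunReal b T n y + 2 * h * gaussCdfReal (b n * (15 / 4 + h - y n)) := by
  have hh : 0 ≤ h := (abs_nonneg _).trans (hy n)
  have hint (u v : ℝ) : IntervalIntegrable (sepKernelReal b n y) volume u v :=
    continuous_sepKernelReal.intervalIntegrable _ _
  have h1 : sepFunReal b T n y' ≤ ∫ t in (0 : ℝ)..T, sepKernelReal b n y (t - 2 * h) :=
    intervalIntegral.integral_mono_on hT (continuous_sepKernelReal.intervalIntegrable _ _)
      ((continuous_sepKernelReal.comp (continuous_sub_right _)).intervalIntegrable _ _)
      fun t _ => sepKernelReal_le_shift hb hy t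
  rw [intervalIntegral.integral_comp_sub_right (sepKernelReal b n y)] at h1
  have h2 : ∫ t in (0 - 2 * h)..0, sepKernelReal b n y t ≤
      (0 - (0 - 2 * h)) * gaussCdfReal (b n * (15 / 4 + h - y n)) :=
    intervalIntegral_le_mul_of_le continuous_sepKernelReal (by linarith) fun t ht =>
      (sepKernelReal_le_last t).trans (gaussCdfReal_mono
        (mul_le_mul_of_nonneg_left (by linarith [ht.1]) (hb n)))
  have h3 : 0 ≤ ∫ t in (T - 2 * h)..T, sepKernelReal b n y t :=
    intervalIntegral.integral_nonneg (by linarith) fun _ _ => sepKernelReal_nonneg _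
  have h4 := intervalIntegral.integral_add_adjacent_intervals
    (hint (0 - 2 * h) (T - 2 * h)) (hint (T - 2 * h) T)
  have h5 := intervalIntegral.integral_add_adjacent_intervals (hint (0 - 2 * h) 0) (hint 0 T)
  unfold sepFunReal at *
  linarith

theorem abs_sepFunReal_sub_le (hb : ∀ j, 0 ≤ b j) (hT : 0 ≤ T) {h C : ℝ}
    (hy : ∀ j, |y' j - y j| ≤ h) (hC : gaussCdfReal (b n * (15 / 4 + h - y n)) ≤ C)
    (hC' : gaussCdfReal (b n * (15 / 4 + h - y' n)) ≤ C) :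
    |sepFunReal b T n y' - sepFunReal b T n y| ≤ 2 * h * C := by
  have hh : 0 ≤ 2 * h := by linarith [(abs_nonneg _).trans (hy n)]
  have h1 := sepFunReal_le_add (n := n) hb hT hy
  have h2 := sepFunReal_le_add (n := n) hb hT (y := y') (y' := y) (h := h)
    fun j => by rw [abs_sub_comm]; exact hy j
  have h3 := mul_le_mul_of_nonneg_left hC hh
  have h4 := mul_le_mul_of_nonneg_left hC' hh
  rw [abs_le]
  constructor <;> linarith

/-- Since t/2 ≤ 1, the threshold 21/8 leaves the margin 21/8 - 3/2 - 1 = 15/4 - 1 - 21/8 = 1/8 in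
every factor. Bernoulli's inequality handles the product of n factors. -/
theorem le_sepFunReal (hT : 0 ≤ T) (hT2 : T ≤ 2) {β : ℝ} (hβ : 0 ≤ β)
    (hb : ∀ j ≤ n, β ≤ b j) (hy : ∀ j < n, 21 / 8 ≤ y j) (hyn : y n ≤ 21 / 8) :
    T * (1 - (n : ℕ) * Real.exp (-(β / 8) ^ 2)) ≤ sepFunReal b T n y := by
  set e := Real.exp (-(β / 8) ^ 2)
  have he : e ≤ 1 := Real.exp_le_one_iff.2 (by nlinarith [sq_nonneg (β / 8)])
  have hfac : ∀ j ≤ n, ∀ s : ℝ, 1 / 8 ≤ s → 1 - e ≤ gaussCdfReal (b j * s) := by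
    intro j hj s hs
    refine (one_sub_le_gaussCdfReal (by positivity)).trans (gaussCdfReal_mono ?_)
    have := mul_le_mul (hb j hj) hs (by norm_num) (hβ.trans (hb j hj))
    linarith
  have hcard : (Finset.Ico 1 n).card + 1 = (n : ℕ) := by
    rw [PNat.card_Ico]
    have := n.pos
    simp only [PNat.one_coe]
    omega
  have hker : ∀ t ∈ Icc 0 T, 1 - (n : ℕ) * e ≤ sepKernelReal b n y t := by
    intro t ht
    calc 1 - (n : ℕ) * e ≤ (1 - e) ^ (n : ℕ) := by
          have := one_add_mul_le_pow (a := -e) (by linarith) (n : ℕ)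
          rw [← sub_eq_add_neg] at this
          linarith
      _ = (∏ j ∈ Finset.Ico 1 n, (1 - e)) * (1 - e) := by
          rw [Finset.prod_const, ← hcard, pow_succ]
      _ ≤ sepKernelReal b n y t := by
          have h0 : 0 ≤ 1 - e := by linarith
          refine mul_le_mul (Finset.prod_le_prod (fun _ _ => h0) fun j hj => ?_) ?_ h0
            (Finset.prod_nonneg fun _ _ => gaussCdfReal_nonneg _)
          · have hj' := (Finset.mem_Ico.1 hj).2
            exact hfac j hj'.le _ (by linarith [hy j hj', ht.2])
          · exact hfac n le_rfl _ (by linarith [ht.2])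
  have := intervalIntegral.integral_mono_on (μ := volume) hT intervalIntegrable_const
    ((continuous_sepKernelReal (b := b) (n := n) (y := y)).intervalIntegrable _ _) hker
  rwa [intervalIntegral.integral_const, sub_zero, smul_eq_mul] at this

end RealEstimates

/-! ### Growth off the real axis. -/

section ComplexEstimates

variable {b : ℕ+ → ℝ} {T : ℝ} {n : ℕ+}

theorem norm_sepKernel_le (w : ℕ+ → ℂ) {V : ℝ} (hV : ∀ j, |(w j).im| ≤ V) (t : ℝ) :
    ‖sepKernel b n w t‖ ≤ Real.exp ((∑ j ∈ Finset.Icc 1 n, b j ^ 2) * V ^ 2) *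
      sepKernelReal b n (fun j => (w j).re) t := by
  have hV2 (j : ℕ+) : (b j * (w j).im) ^ 2 ≤ b j ^ 2 * V ^ 2 := by
    rw [mul_pow]
    refine mul_le_mul_of_nonneg_left ?_ (sq_nonneg _)
    exact sq_le_sq' (neg_le_of_abs_le (hV j)) (le_of_abs_le (hV j))
  have hfac (j : ℕ+) : ‖gaussCdf (b j * (w j - 3 / 2 - t / 2))‖ ≤
      Real.exp (b j ^ 2 * V ^ 2) * gaussCdfReal (b j * ((w j).re - 3 / 2 - t / 2)) := by
    refine (norm_gaussCdf_le _).trans ?_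
    have hre : ((b j : ℂ) * (w j - 3 / 2 - t / 2)).re = b j * ((w j).re - 3 / 2 - t / 2) := by
      rw [Complex.re_ofReal_mul]; simp
    have him : ((b j : ℂ) * (w j - 3 / 2 - t / 2)).im = b j * (w j).im := by
      rw [Complex.im_ofReal_mul]; simp
    rw [hre, him]
    exact mul_le_mul_of_nonneg_right (Real.exp_le_exp.2 (hV2 j)) (gaussCdfReal_nonneg _)
  have hlast : ‖gaussCdf (b n * (15 / 4 - t / 2 - w n))‖ ≤
      Real.exp (b n ^ 2 * V ^ 2) * gaussCdfReal (b n * (15 / 4 - t / 2 - (w n).re)) := by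
    refine (norm_gaussCdf_le _).trans ?_
    have hre : ((b n : ℂ) * (15 / 4 - t / 2 - w n)).re = b n * (15 / 4 - t / 2 - (w n).re) := by
      rw [Complex.re_ofReal_mul]; simp
    have him : ((b n : ℂ) * (15 / 4 - t / 2 - w n)).im = -(b n * (w n).im) := by
      rw [Complex.im_ofReal_mul]; simp
    rw [hre, him, neg_sq]
    exact mul_le_mul_of_nonneg_right (Real.exp_le_exp.2 (hV2 n)) (gaussCdfReal_nonneg _)
  unfold sepKernel sepKernelReal
  rw [norm_mul, norm_prod, ← Finset.sum_Ico_add_eq_sum_Icc one_le, add_mul, Real.exp_add,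
    Finset.sum_mul, Real.exp_sum, mul_mul_mul_comm, ← Finset.prod_mul_distrib]
  exact mul_le_mul (Finset.prod_le_prod (fun _ _ => norm_nonneg _) fun j _ => hfac j) hlast
    (norm_nonneg _) (Finset.prod_nonneg fun _ _ =>
      mul_nonneg (Real.exp_pos _).le (gaussCdfReal_nonneg _))

theorem norm_sepFun_le (hT : 0 ≤ T) (w : ℕ+ → ℂ) {V : ℝ} (hV : ∀ j, |(w j).im| ≤ V) :
    ‖sepFun b T n w‖ ≤ Real.exp ((∑ j ∈ Finset.Icc 1 n, b j ^ 2) * V ^ 2) *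
      sepFunReal b T n (fun j => (w j).re) := by
  unfold sepFun sepFunReal
  rw [← intervalIntegral.integral_const_mul]
  refine intervalIntegral.norm_integral_le_of_norm_le hT
    (Filter.Eventually.of_forall fun t _ => norm_sepKernel_le w hV t) ?_
  exact (continuous_const.mul continuous_sepKernelReal).intervalIntegrable _ _

end ComplexEstimates

/-! ### Holomorphy of the smoothed minimum. -/

/-- An integral over a compact interval of a function holomorphic in all variables is holomorphic
in the remaining variables. -/
theorem ContDiff.differentiable_intervalIntegral {H : Type*} [NormedAddCommGroup H]
    [NormedSpace ℂ H] [ProperSpace H] {F : H × ℂ → ℂ} (hF : ContDiff ℂ 1 F) (u v : ℝ) :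
    Differentiable ℂ fun w => ∫ t in u..v, F (w, (t : ℂ)) := by
  intro w₀
  have hcont : Continuous fun p : H × ℝ => F (p.1, (p.2 : ℂ)) := by
    have := hF.continuous
    fun_prop
  have hcont' : Continuous fun p : H × ℝ =>
      (fderiv ℂ F (p.1, (p.2 : ℂ))).comp (ContinuousLinearMap.inl ℂ H ℂ) := by
    have := hF.continuous_fderiv one_ne_zero
    fun_prop
  -- Properness of `H` makes the closed ball compact, so the partial derivative has a constant
  -- dominating bound.
  obtain ⟨C, hC⟩ := ((isCompact_closedBall w₀ 1).prod
    (isCompact_uIcc (a := u) (b := v))).exists_bound_of_continuousOn hcont'.continuousOn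
  have key := intervalIntegral.hasFDerivAt_integral_of_dominated_of_fderiv_le (𝕜 := ℂ)
    (μ := volume) (a := u) (b := v) (F := fun (w : H) (t : ℝ) => F (w, (t : ℂ)))
    (F' := fun w t => (fderiv ℂ F (w, (t : ℂ))).comp (ContinuousLinearMap.inl ℂ H ℂ))
    (x₀ := w₀) (s := Metric.ball w₀ 1) (bound := fun _ => C) (Metric.ball_mem_nhds _ one_pos)
    (Filter.Eventually.of_forall fun w =>
      (hcont.comp (Continuous.prodMk_right w)).aestronglyMeasurable)
    ((hcont.comp (Continuous.prodMk_right w₀)).intervalIntegrable _ _)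
    (hcont'.comp (Continuous.prodMk_right w₀)).aestronglyMeasurable
    (Filter.Eventually.of_forall fun t ht w hw =>
      hC (w, t) ⟨Metric.ball_subset_closedBall hw, uIoc_subset_uIcc ht⟩)
    intervalIntegrable_const
    (Filter.Eventually.of_forall fun t _ w _ => by
      have h1 := (hF.differentiable one_ne_zero (w, (t : ℂ))).hasFDerivAt
      exact h1.comp w (hasFDerivAt_prodMk_left w (t : ℂ)))
  exact key.differentiableAt

theorem DifferentiableOn.sepFun {E : Type*} [NormedAddCommGroup E] [NormedSpace ℂ E] {s : Set E}
    {W : E → ℕ+ → ℂ} (hW : ∀ j, DifferentiableOn ℂ (fun e => W e j) s) (b : ℕ+ → ℝ) (T : ℝ)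
    (n : ℕ+) : DifferentiableOn ℂ (fun e => sepFun b T n (W e)) s := by
  -- Only the coordinates up to n matter. Extending by zero from `Finset.Icc 1 n` reduces the claim
  -- to a finite-dimensional, hence proper, parameter space.
  let ext : (Finset.Icc 1 n → ℂ) → ℕ+ → ℂ :=
    fun v j => if h : j ∈ Finset.Icc 1 n then v ⟨j, h⟩ else 0
  have hext (j : ℕ+) : ContDiff ℂ 1 fun p : (Finset.Icc 1 n → ℂ) × ℂ => ext p.1 j := by
    by_cases h : j ∈ Finset.Icc 1 n
    · simp only [ext, h, dif_pos]
      fun_prop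
    · simp only [ext, h]
      exact contDiff_const
  have hg : ContDiff ℂ 1 gaussCdf := differentiable_gaussCdf.contDiff
  have hker : ContDiff ℂ 1 fun p : (Finset.Icc 1 n → ℂ) × ℂ => sepKernel b n (ext p.1) p.2 := by
    unfold sepKernel
    refine ContDiff.mul (contDiff_prod fun j _ => hg.comp ?_) (hg.comp ?_)
    · exact contDiff_const.mul (((hext j).sub contDiff_const).sub (contDiff_snd.div_const 2))
    · exact contDiff_const.mul ((contDiff_const.sub (contDiff_snd.div_const 2)).sub (hext n))
  have hdiff := hker.differentiable_intervalIntegral 0 T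
  have hrestr : DifferentiableOn ℂ (fun e (i : Finset.Icc 1 n) => W e i) s :=
    differentiableOn_pi.2 fun i => hW i
  refine (hdiff.comp_differentiableOn hrestr).congr fun e _ => ?_
  have hmem {j : ℕ+} (hj : j ≤ n) : ext (fun i => W e i) j = W e j :=
    dif_pos (Finset.mem_Icc.2 ⟨one_le, hj⟩)
  refine intervalIntegral.integral_congr fun t _ => ?_
  simp only [sepKernel]
  rw [hmem le_rfl]
  congr 1
  refine Finset.prod_congr rfl fun j hj => ?_
  rw [hmem (Finset.mem_Ico.1 hj).2.le]

/-! ### The embedding of X and the strip. -/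

open Filter Topology TaylorComplexification

namespace TaylorComplexification

variable {X : Type*} [NormedAddCommGroup X]

theorem ofReal_add (x y : X) : ofReal (x + y) = ofReal x + ofReal y := by
  ext <;> simp [ofReal]

variable [NormedSpace ℝ X]

theorem norm_ofReal (x : X) : ‖ofReal x‖ = ‖x‖ := by
  refine le_antisymm ?_ (by simpa [ofReal] using le_norm (ofReal x) 0)
  rw [norm_def]
  refine ciSup_le fun θ => ?_
  simp only [ofReal, smul_zero, sub_zero, norm_smul]
  exact mul_le_of_le_one_left (norm_nonneg _) (Real.abs_cos_le_one θ)

variable (X) in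
/-- The canonical embedding of `X` into its complexification as a continuous linear map. -/
noncomputable def ofRealCLM : X →L[ℝ] TaylorComplexification X :=
  LinearMap.mkContinuous
    { toFun := ofReal
      map_add' := ofReal_add
      map_smul' := fun c x => by
        change ofReal (c • x) = (c : ℂ) • ofReal x
        ext
        · rw [smul_re]; simp [ofReal]
        · rw [smul_im]; simp [ofReal] } 1 fun x => by simp [norm_ofReal]

@[simp] theorem ofRealCLM_apply (x : X) : ofRealCLM X x = ofReal x := rfl

theorem ofReal_sub (x y : X) : ofReal (x - y) = ofReal x - ofReal y :=
  map_sub (ofRealCLM X) x y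

theorem ofReal_add_mem_strip (x : X) {z : TaylorComplexification X} {δ : ℝ} (hz : ‖z‖ < δ) :
    ofReal x + z ∈ strip X δ := ⟨x, z, hz, rfl⟩

theorem ofReal_mem_strip (x : X) {δ : ℝ} (hδ : 0 < δ) : ofReal x ∈ strip X δ := by
  simpa using ofReal_add_mem_strip x (z := 0) (by simpa using hδ)

theorem sub_ofReal_mem_strip {w : TaylorComplexification X} {δ : ℝ} (hw : w ∈ strip X δ) (y : X) :
    w - ofReal y ∈ strip X δ := by
  obtain ⟨x, z, hz, rfl⟩ := hw
  exact ⟨x - y, z, hz, by rw [ofReal_sub]; abel⟩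

theorem isOpen_strip (δ : ℝ) : IsOpen (strip X δ) := by
  have : strip X δ = ⋃ x : X, Metric.ball (ofReal x) δ := by
    ext w
    simp only [mem_iUnion, mem_ball_iff_norm]
    constructor
    · rintro ⟨x, z, hz, rfl⟩
      exact ⟨x, by simpa using hz⟩
    · rintro ⟨x, hx⟩
      exact ⟨x, w - ofReal x, hx, by abel⟩
  rw [this]
  exact isOpen_iUnion fun _ => Metric.isOpen_ball

end TaylorComplexification


/-! ### Dyadic slopes and the size of the tails. -/

section Scale

/-- The geometrically decreasing scales `k 2^{-j}`. -/
noncomputable def dyadicScale (k : ℝ) (j : ℕ+) : ℝ := k / 2 ^ (j : ℕ)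

theorem dyadicScale_nonneg {k : ℝ} (hk : 0 ≤ k) (j : ℕ+) : 0 ≤ dyadicScale k j := by
  unfold dyadicScale; positivity

theorem dyadicScale_anti {k : ℝ} (hk : 0 ≤ k) {i j : ℕ+} (hij : i ≤ j) :
    dyadicScale k j ≤ dyadicScale k i := by
  have : (i : ℕ) ≤ j := hij
  unfold dyadicScale
  gcongr
  norm_num

theorem sum_dyadicScale_sq_le (k : ℝ) (n : ℕ+) :
    ∑ j ∈ Finset.Icc 1 n, dyadicScale k j ^ 2 ≤ k ^ 2 := by
  -- Subtracting the last square gives a statement that passes through the induction, since each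
  -- slope is twice the next.
  have h : ∑ j ∈ Finset.Icc 1 n, dyadicScale k j ^ 2 ≤ k ^ 2 - dyadicScale k n ^ 2 := by
    induction n using PNat.recOn with
    | one =>
      simp only [Finset.Icc_self, Finset.sum_singleton, dyadicScale, PNat.one_coe]
      nlinarith [sq_nonneg k]
    | succ n ih =>
      have hI : Finset.Ico 1 (n + 1) = Finset.Icc 1 n := by
        ext j; simp
      rw [← Finset.sum_Ico_add_eq_sum_Icc one_le, hI]
      have hs : dyadicScale k n = 2 * dyadicScale k (n + 1) := by
        simp only [dyadicScale, PNat.add_coe, PNat.one_coe, pow_succ]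
        field_simp
      rw [hs] at ih
      nlinarith [sq_nonneg (dyadicScale k (n + 1))]
  linarith [sq_nonneg (dyadicScale k n)]

/-- The size of the tails of `sepFun (dyadicScale k) T n`. -/
noncomputable def dyadicTail (k : ℝ) (n : ℕ+) : ℝ := Real.exp (-(dyadicScale k n) ^ 2 / 128)

theorem dyadicTail_pos (k : ℝ) (n : ℕ+) : 0 < dyadicTail k n := Real.exp_pos _

theorem exists_dyadicTail_lt (n : ℕ+) {e : ℝ} (he : 0 < e) : ∃ k, 0 < k ∧ dyadicTail k n < e := by
  have h1 : Tendsto (fun k : ℝ => (dyadicScale k n) ^ 2 / 128) atTop atTop := by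
    refine Tendsto.atTop_div_const (by norm_num) ?_
    exact (tendsto_pow_atTop two_ne_zero).comp (tendsto_id.atTop_div_const (by positivity))
  have h2 : Tendsto (fun k : ℝ => dyadicTail k n) atTop (𝓝 0) := by
    refine (Real.tendsto_exp_neg_atTop_nhds_zero.comp h1).congr fun k => ?_
    simp [dyadicTail, neg_div]
  exact ((eventually_gt_atTop 0).and (h2.eventually_lt_const he)).exists

theorem gaussCdfReal_mul_le {β s : ℝ} (hβ : 0 ≤ β) (hs : s ≤ -(1 / 8)) :
    gaussCdfReal (β * s) ≤ Real.exp (-β ^ 2 / 64) := by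
  have h : β * s ≤ -(β / 8) := by nlinarith
  refine (gaussCdfReal_mono h).trans ((gaussCdfReal_neg_le (by positivity)).trans_eq ?_)
  ring_nf

theorem gaussCdfReal_dyadicScale_mul_le {k s : ℝ} (hk : 0 ≤ k) (hs : s ≤ -(1 / 8)) (n : ℕ+) :
    gaussCdfReal (dyadicScale k n * s) ≤ dyadicTail k n := by
  refine (gaussCdfReal_mul_le (dyadicScale_nonneg hk n) hs).trans (Real.exp_le_exp.2 ?_)
  linarith [sq_nonneg (dyadicScale k n)]

variable {k ε : ℝ} {n : ℕ+}

theorem one_lt_sepFunReal (hk : 0 ≤ k) (hε : 0 < ε) (hε1 : ε < 1)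
    (htail : n * dyadicTail k n ≤ ε / 4) {y : ℕ+ → ℝ} (hy : ∀ j < n, 21 / 8 ≤ y j)
    (hyn : y n ≤ 21 / 8) : 1 < sepFunReal (dyadicScale k) (1 + ε) n y := by
  have h := le_sepFunReal (T := 1 + ε) (by linarith) (by linarith) (dyadicScale_nonneg hk n)
    (fun j hj => dyadicScale_anti hk hj) hy hyn
  have h1 : Real.exp (-(dyadicScale k n / 8) ^ 2) ≤ dyadicTail k n := by
    refine Real.exp_le_exp.2 ?_
    linarith [sq_nonneg (dyadicScale k n)]
  have h2 := mul_le_mul_of_nonneg_left h1 (Nat.cast_nonneg (α := ℝ) (n : ℕ))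
  refine lt_of_lt_of_le ?_ h
  -- The bound reduces to (1 + ε)(1 - ε/4) > 1 for 0 < ε < 1.
  nlinarith

theorem sepFunReal_le_of_four_le (hk : 0 ≤ k) (hε : 0 ≤ ε) (hε1 : ε ≤ 1)
    (htail : 2 * dyadicTail k n ≤ ε) {y : ℕ+ → ℝ} (hyn : 4 ≤ y n) :
    sepFunReal (dyadicScale k) (1 + ε) n y ≤ ε := by
  have h := sepFunReal_le_last (T := 1 + ε) (y := y) (by linarith) (dyadicScale_nonneg hk n)
  have h1 := gaussCdfReal_dyadicScale_mul_le (s := 15 / 4 - y n) hk (by linarith) n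
  have h2 := mul_le_mul_of_nonneg_left h1 (by linarith : 0 ≤ 1 + ε)
  nlinarith [dyadicTail_pos k n]

/-- The decay of the i-th factor outweighs the complex growth of all factors together, for every k
at once: the hypotheses on w involve i but not k. -/
theorem norm_sepFun_le_tail (hk : 0 ≤ k) (hε : 0 ≤ ε) (hε1 : ε ≤ 1) {i : ℕ+} (hi : i < n)
    {w : ℕ+ → ℂ} (him : ∀ j, |(w j).im| ≤ 1 / (16 * 2 ^ (i : ℕ))) (hre : (w i).re ≤ 11 / 8) :
    ‖sepFun (dyadicScale k) (1 + ε) n w‖ ≤ 2 * dyadicTail k n := by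
  set β := dyadicScale k i
  have h1 := norm_sepFun_le (b := dyadicScale k) (n := n) (by linarith : 0 ≤ 1 + ε) w him
  have h2 := sepFunReal_le_of_lt (b := dyadicScale k) (y := fun j => (w j).re)
    (by linarith : 0 ≤ 1 + ε) hi (dyadicScale_nonneg hk i)
  have h3 := gaussCdfReal_mul_le (β := β) (s := (w i).re - 3 / 2) (dyadicScale_nonneg hk i)
    (by linarith)
  have h4 : (∑ j ∈ Finset.Icc 1 n, dyadicScale k j ^ 2) * (1 / (16 * 2 ^ (i : ℕ))) ^ 2 ≤
      β ^ 2 / 256 := by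
    refine (mul_le_mul_of_nonneg_right (sum_dyadicScale_sq_le k n) (sq_nonneg _)).trans_eq ?_
    simp only [β, dyadicScale]
    field_simp
    norm_num
  have h5 : dyadicScale k n ^ 2 ≤ β ^ 2 :=
    pow_le_pow_left₀ (dyadicScale_nonneg hk n) (dyadicScale_anti hk hi.le) 2
  have hc0 := gaussCdfReal_nonneg (β * ((w i).re - 3 / 2))
  calc _ ≤ _ := h1
    _ ≤ Real.exp (β ^ 2 / 256) * (2 * Real.exp (-β ^ 2 / 64)) := by
        refine mul_le_mul (Real.exp_le_exp.2 h4) (h2.trans ?_) (sepFunReal_nonneg (by linarith))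
          (Real.exp_pos _).le
        exact mul_le_mul (by linarith) h3 hc0 (by norm_num)
    _ = 2 * Real.exp (β ^ 2 / 256 + -β ^ 2 / 64) := by rw [Real.exp_add]; ring
    -- Here 1/256 - 1/64 = -3/256 ≤ -1/128, and the slope at i is at least the slope at n.
    _ ≤ 2 * dyadicTail k n := by
        refine mul_le_mul_of_nonneg_left (Real.exp_le_exp.2 ?_) zero_le_two
        nlinarith [sq_nonneg β]

theorem norm_sepFun_le_exp (hε : 0 ≤ ε) {w : ℕ+ → ℂ} {V : ℝ} (him : ∀ j, |(w j).im| ≤ V) :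
    ‖sepFun (dyadicScale k) (1 + ε) n w‖ ≤ Real.exp (k ^ 2 * V ^ 2) * (1 + ε) := by
  refine (norm_sepFun_le (by linarith) w him).trans ?_
  refine mul_le_mul (Real.exp_le_exp.2 ?_) (sepFunReal_le (by linarith))
    (sepFunReal_nonneg (by linarith)) (Real.exp_pos _).le
  exact mul_le_mul_of_nonneg_right (sum_dyadicScale_sq_le k n) (sq_nonneg _)

end Scale

/-! ### Composition with the scaled translates of Q. -/

section Construction

variable {X : Type*} [NormedAddCommGroup X]

/-- The admissible Lipschitz constants form a closed set, so their infimum is attained. -/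
theorem abs_sub_le_lipConst {Q : X → ℝ} (h : ∃ C, LipschitzWith C Q) (x y : X) :
    |Q x - Q y| ≤ lipConst Q * ‖x - y‖ := by
  have hcl : IsClosed {C : NNReal | LipschitzWith C Q} := by
    simp only [lipschitzWith_iff_dist_le_mul, ofPred_forall]
    refine isClosed_iInter fun x => isClosed_iInter fun y => isClosed_le (by fun_prop) ?_
    exact (NNReal.continuous_coe).mul continuous_const
  have hmem : LipschitzWith (sInf {C : NNReal | LipschitzWith C Q}) Q :=
    hcl.csInf_mem h (OrderBot.bddBelow _)
  have := hmem.dist_le_mul x y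
  rwa [Real.dist_eq, dist_eq_norm] at this

theorem lipConst_nonneg (Q : X → ℝ) : 0 ≤ lipConst Q := NNReal.coe_nonneg _

theorem abs_scaled_sub_le {Q : X → ℝ} (hQ : ∃ C, LipschitzWith C Q) (p : ℕ+ → X) {r : ℝ} (hr : 0 < r)
    (x y : X) (j : ℕ+) : |Q (x - p j) / r - Q (y - p j) / r| ≤ lipConst Q / r * ‖x - y‖ := by
  rw [← sub_div, abs_div, abs_of_pos hr, div_mul_eq_mul_div]
  refine div_le_div_of_nonneg_right ?_ hr.le
  simpa using abs_sub_le_lipConst hQ (x - p j) (y - p j)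

variable [NormedSpace ℝ X]

namespace IsLipschitzHolomorphicExtension

variable {Q : X → ℝ} {δQ : ℝ} {Qt : TaylorComplexification X → ℂ}

theorem exists_lipschitzWith (h : IsLipschitzHolomorphicExtension Q δQ Qt) :
    ∃ C, LipschitzWith C Q := by
  obtain ⟨C, hC⟩ := h.lipschitz
  refine ⟨C, LipschitzWith.of_dist_le_mul fun x y => ?_⟩
  have := hC.dist_le_mul _ (ofReal_mem_strip x h.pos) _ (ofReal_mem_strip y h.pos)
  rw [h.extends_real, h.extends_real, dist_eq_norm, dist_eq_norm, ← ofReal_sub, norm_ofReal,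
    ← Complex.ofReal_sub, Complex.norm_real] at this
  rwa [dist_eq_norm, dist_eq_norm]

/-- The functions of which the separating functions are composed. -/
noncomputable def _root_.scaledTranslates (Qt : TaylorComplexification X → ℂ) (p : ℕ+ → X) (r : ℝ)
    (w : TaylorComplexification X) (j : ℕ+) : ℂ := Qt (w - ofReal (p j)) / r

theorem scaledTranslates_ofReal (h : IsLipschitzHolomorphicExtension Q δQ Qt) (p : ℕ+ → X) (r : ℝ)
    (x : X) : scaledTranslates Qt p r (ofReal x) = fun j => ((Q (x - p j) / r : ℝ) : ℂ) := by
  ext j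
  rw [scaledTranslates, ← ofReal_sub, h.extends_real]
  push_cast
  rfl

theorem norm_scaledTranslates_sub_le (h : IsLipschitzHolomorphicExtension Q δQ Qt) {C : NNReal}
    (hC : LipschitzOnWith C Qt (strip X δQ)) (p : ℕ+ → X) {r : ℝ} (hr : 0 < r) (x : X)
    {z : TaylorComplexification X} (hz : ‖z‖ < δQ) (j : ℕ+) :
    ‖scaledTranslates Qt p r (ofReal x + z) j - ((Q (x - p j) / r : ℝ) : ℂ)‖ ≤ C * ‖z‖ / r := by
  have h1 : scaledTranslates Qt p r (ofReal x + z) j - ((Q (x - p j) / r : ℝ) : ℂ) =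
      (Qt (ofReal (x - p j) + z) - Qt (ofReal (x - p j))) / r := by
    rw [scaledTranslates, h.extends_real, ofReal_sub, add_sub_right_comm]
    push_cast
    ring
  rw [h1, norm_div, Complex.norm_real, Real.norm_of_nonneg hr.le]
  refine div_le_div_of_nonneg_right ?_ hr.le
  have := hC.dist_le_mul _ (ofReal_add_mem_strip (x - p j) hz) _ (ofReal_mem_strip (x - p j) h.pos)
  simpa [dist_eq_norm] using this

theorem differentiableOn_sepFun (h : IsLipschitzHolomorphicExtension Q δQ Qt) (p : ℕ+ → X)
    (r : ℝ) (b : ℕ+ → ℝ) (T : ℝ) (n : ℕ+) :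
    DifferentiableOn ℂ (fun w => sepFun b T n (scaledTranslates Qt p r w)) (strip X δQ) := by
  refine DifferentiableOn.sepFun (fun j => ?_) b T n
  have hcomp : DifferentiableOn ℂ (fun w => Qt (w - ofReal (p j))) (strip X δQ) :=
    h.holomorphic.comp (by fun_prop) fun w hw => sub_ofReal_mem_strip hw _
  simpa only [scaledTranslates, div_eq_mul_inv] using hcomp.mul_const ((r : ℂ)⁻¹)

theorem differentiableAt_sepFunReal (h : IsLipschitzHolomorphicExtension Q δQ Qt) (p : ℕ+ → X)
    (r : ℝ) (b : ℕ+ → ℝ) (T : ℝ) (n : ℕ+) (x : X) :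
    DifferentiableAt ℝ (fun x => sepFunReal b T n fun j => Q (x - p j) / r) x := by
  have h1 : DifferentiableAt ℂ (fun w => sepFun b T n (scaledTranslates Qt p r w)) (ofReal x) :=
    (h.differentiableOn_sepFun p r b T n).differentiableAt
      ((isOpen_strip δQ).mem_nhds (ofReal_mem_strip x h.pos))
  have h2 := (h1.restrictScalars ℝ).comp x (ofRealCLM X).differentiableAt
  have h3 := Complex.reCLM.differentiableAt.comp x h2
  refine h3.congr_of_eventuallyEq (Eventually.of_forall fun y => ?_)
  simp only [Function.comp_apply, h.scaledTranslates_ofReal, sepFun_ofReal]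
  simp

end IsLipschitzHolomorphicExtension

variable {Q : X → ℝ}

theorem norm_fderiv_sepFunReal_le (hQ : ∃ C, LipschitzWith C Q) (p : ℕ+ → X) {r : ℝ} (hr : 0 < r)
    {k T : ℝ} (hk : 0 ≤ k) (hT : 0 ≤ T) (n : ℕ+) {x : X} (hx : 5 ≤ Q (x - p n) / r) :
    ‖fderiv ℝ (fun x => sepFunReal (dyadicScale k) T n fun j => Q (x - p j) / r) x‖ ≤
      2 * (lipConst Q / r) * dyadicTail k n := by
  have hL : 0 ≤ lipConst Q / r := div_nonneg (lipConst_nonneg Q) hr.le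
  refine norm_fderiv_le_of_lip' ℝ (by have := dyadicTail_pos k n; positivity) ?_
  -- With h < 1/2, both y_n ≥ 5 and the perturbed value, above 9/2, keep 15/4 + h - y_n below -1/8.
  have hsmall : ∀ᶠ x' in 𝓝 x, lipConst Q / r * ‖x' - x‖ < 1 / 2 := by
    have : Continuous fun x' : X => lipConst Q / r * ‖x' - x‖ := by fun_prop
    refine this.continuousAt.eventually_lt_const ?_
    simp
  filter_upwards [hsmall] with x' hx'
  have hy := abs_scaled_sub_le hQ p hr x' x
  have hyn := abs_le.1 (hy n)
  have := abs_sepFunReal_sub_le (n := n) (C := dyadicTail k n) (fun j => dyadicScale_nonneg hk j)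
    hT hy (gaussCdfReal_dyadicScale_mul_le hk (by linarith) n)
    (gaussCdfReal_dyadicScale_mul_le hk (by linarith [hyn.1]) n)
  rw [Real.norm_eq_abs]
  linarith

end Construction

/-! ### Choice of covering radii, indices and scales. -/

section Construction

variable {X : Type*} [NormedAddCommGroup X]

/-- Independence of r for r ≥ 1 requires one radius serving all admissible r ≥ 1. An admissible
radius within a factor 5/4 of their infimum does, the infimum being at least 1. Radii below 1 are
left unchanged. -/
theorem exists_uniform_covering_radius (Q : X → ℝ) (p : ℕ+ → X) :
    ∃ σ : ℝ → ℝ, (∀ r, 0 < r → CoversAtRadius Q p r →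
      CoversAtRadius Q p (σ r) ∧ σ r ≤ 5 / 4 * r) ∧ ∀ r s, 1 ≤ r → 1 ≤ s → σ r = σ s := by
  set S := {r : ℝ | 1 ≤ r ∧ CoversAtRadius Q p r}
  have hbdd : BddBelow S := ⟨1, fun r hr => hr.1⟩
  obtain ⟨r₁, hr₁⟩ : ∃ r₁, ∀ r ∈ S, CoversAtRadius Q p r₁ ∧ r₁ ≤ 5 / 4 * r := by
    rcases S.eq_empty_or_nonempty with hS | hS
    · exact ⟨0, by simp [hS]⟩
    · have h1 : 1 ≤ sInf S := le_csInf hS fun r hr => hr.1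
      obtain ⟨r₁, hr₁, hlt⟩ := exists_lt_of_csInf_lt hS (by linarith : sInf S < 5 / 4 * sInf S)
      exact ⟨r₁, fun r hr => ⟨hr₁.2, by linarith [csInf_le hbdd hr]⟩⟩
  refine ⟨fun r => if 1 ≤ r then r₁ else r, fun r hr hcov => ?_, fun r s hr hs => ?_⟩
  · by_cases h : 1 ≤ r
    · simpa [h] using hr₁ r ⟨h, hcov⟩
    · simp only [h, if_false]
      exact ⟨hcov, by linarith⟩
  · simp [hr, hs]

theorem CoversAtRadius.exists_lt {Q : X → ℝ} {p : ℕ+ → X} {r : ℝ} (h : CoversAtRadius Q p r)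
    (x : X) : ∃ j, Q (x - p j) < r := by
  have : x ∈ ⋃ j, QBody Q (p j) r := h ▸ mem_univ x
  obtain ⟨j, hj⟩ := mem_iUnion.1 this
  exact ⟨j, hj⟩

/-- Shrinking the radius shrinks the set of indices whose bodies contain x, so the least such index
can only grow. -/
theorem exists_first_index (Q : X → ℝ) (p : ℕ+ → X) (c : ℝ) (hc : 1 ≤ c) :
    ∃ m : X → ℝ → ℕ+, (∀ x r, 0 < r → CoversAtRadius Q p r →
      Q (x - p (m x r)) < c * r ∧ ∀ j < m x r, c * r ≤ Q (x - p j)) ∧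
      ∀ x r s, 0 < s → s ≤ r → CoversAtRadius Q p s → CoversAtRadius Q p r → m x r ≤ m x s := by
  classical
  have hex : ∀ x r, 0 < r → CoversAtRadius Q p r → ∃ j, Q (x - p j) < c * r := by
    intro x r hr h
    obtain ⟨j, hj⟩ := h.exists_lt x
    exact ⟨j, by nlinarith⟩
  refine ⟨fun x r => if h : ∃ j, Q (x - p j) < c * r then PNat.find h else 1, ?_, ?_⟩
  · intro x r hr hcov
    have h := hex x r hr hcov
    simp only [h, dif_pos]
    exact ⟨PNat.find_spec h, fun j hj => not_lt.1 (PNat.find_min h hj)⟩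
  · intro x r s hs hsr hcs hcr
    have h := hex x r (hs.trans_le hsr) hcr
    have h' := hex x s hs hcs
    simp only [h, h', dif_pos]
    exact PNat.find_min' h ((PNat.find_spec h').trans_le (by nlinarith))

/-- Continuity at 0 gives one radius for finitely many n; the larger n will be covered by the decay
estimate. -/
theorem exists_small_radius (k : ℕ+ → ℝ) (C : ℝ) (N : ℕ+) {δ ε : ℝ} (hδ : 0 < δ) (hε : 0 < ε) :
    ∃ δ', 0 < δ' ∧ δ' < δ ∧ ∀ n ≤ N, Real.exp (k n ^ 2 * (C * δ') ^ 2) * (1 + ε) ≤ 1 + 2 * ε := by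
  have h (n : ℕ+) : ∀ᶠ t in 𝓝[>] (0 : ℝ),
      Real.exp (k n ^ 2 * (C * t) ^ 2) * (1 + ε) < 1 + 2 * ε := by
    have hc : Continuous fun t : ℝ => Real.exp (k n ^ 2 * (C * t) ^ 2) * (1 + ε) := by fun_prop
    refine (hc.tendsto 0).mono_left nhdsWithin_le_nhds |>.eventually_lt_const ?_
    simp
    linarith
  have h' : ∀ᶠ t in 𝓝[>] (0 : ℝ), ∀ n ∈ Finset.Icc 1 N,
      Real.exp (k n ^ 2 * (C * t) ^ 2) * (1 + ε) < 1 + 2 * ε :=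
    (Finset.eventually_all _).2 fun n _ => h n
  obtain ⟨t, ht, hlt, hpos⟩ := (h'.and ((eventually_lt_nhds hδ).filter_mono
    nhdsWithin_le_nhds |>.and eventually_mem_nhdsWithin)).exists
  exact ⟨t, hpos, hlt, fun n hn => (ht n (Finset.mem_Icc.2 ⟨one_le, hn⟩)).le⟩

/-- A scale for which all tails of the `n`-th separating function are small enough. -/
theorem exists_scale (L : ℝ) (hL : 0 ≤ L) (A : ℝ) (hA : 0 < A) (n : ℕ+) {ρ ε : ℝ} (hρ : 0 < ρ)
    (hε : 0 < ε) : ∃ k, 0 < k ∧ n * dyadicTail k n ≤ ε / 4 ∧ 2 * dyadicTail k n ≤ ε ∧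
      2 * (L / ρ) * dyadicTail k n ≤ ε ∧ 2 * dyadicTail k n < 1 / A := by
  have hn : (0 : ℝ) < n := by exact_mod_cast n.pos
  have hM : 0 < 4 * n + 2 * (L / ρ) + 2 := by positivity
  obtain ⟨k, hk, hlt⟩ := exists_dyadicTail_lt n
    (lt_min (div_pos hε hM) (by positivity : 0 < 1 / A / 2))
  have h0 := dyadicTail_pos k n
  have h1 := (lt_div_iff₀ hM).1 (lt_min_iff.1 hlt).1
  have h2 := (lt_min_iff.1 hlt).2
  have h3 : 0 ≤ L / ρ * dyadicTail k n := by positivity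
  have h4 : 0 < n * dyadicTail k n := by positivity
  refine ⟨k, hk, ?_, ?_, ?_, ?_⟩ <;> nlinarith

end Construction

/-! ### Assembly of the separating functions. -/

theorem exists_separating_functions {X : Type*} [NormedAddCommGroup X] [NormedSpace ℝ X]
    {Q : X → ℝ} {δQ : ℝ} {Qt : TaylorComplexification X → ℂ}
    (hQt : IsLipschitzHolomorphicExtension Q δQ Qt) (K : ℝ) {η : ℝ} (hη : 0 ≤ η)
    (p : ℕ+ → X) :
    ∃ (φt : ℕ+ → ℝ → ℝ → TaylorComplexification X → ℂ) (φ : ℕ+ → ℝ → ℝ → X → ℝ)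
      (m N : X → ℝ → ℕ+) (a δ : X → ℝ → ℝ) (Nε : X → ℝ → ℝ → ℕ+) (δε : X → ℝ → ℝ → ℝ),
      (∀ r : ℝ, 0 < r → CoversAtRadius Q p r → ∀ ε : ℝ, 0 < ε → ε < 1 →
        (∀ n, DifferentiableOn ℂ (φt n r ε) (strip X δQ)) ∧
        (∀ n x, φt n r ε (ofReal x) = (φ n r ε x : ℂ)) ∧
        (∀ n x, φ n r ε x ∈ Set.Icc (0 : ℝ) 2) ∧
        (∀ n x y, |φ n r ε x - φ n r ε y| ≤ 2 * lipConst Q / r * ‖x - y‖) ∧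
        (∀ n x, 0 ≤ φ n r ε x ∧ φ n r ε x ≤ 1 + ε) ∧
        (∀ x, 1 < φ (m x r) r ε x) ∧
        (∀ n x, x ∉ QBody Q (p n) (4 * r) → 0 ≤ φ n r ε x ∧ φ n r ε x ≤ ε) ∧
        (∀ n x, x ∉ QBody Q (p n) (5 * r) →
          |φ n r ε x| ≤ ε ∧ DifferentiableAt ℝ (φ n r ε) x ∧ ‖fderiv ℝ (φ n r ε) x‖ ≤ ε) ∧
        (∀ x, 0 < a x r ∧ 0 < δ x r ∧ δ x r ≤ δQ ∧
          ∀ (n : ℕ+) (z : TaylorComplexification X), N x r < n → ‖z‖ < δ x r →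
            ‖φt n r ε (ofReal x + z)‖ <
              1 / ((Nat.factorial n : ℝ) * a x r ^ (n : ℕ) *
                (Real.exp (2 * K ^ 2 * η) * (1 + ‖p n‖)))) ∧
        (∀ x (n : ℕ+) (z : TaylorComplexification X), Nε x r ε < n → ‖z‖ < δ x r →
          ‖φt n r ε (ofReal x + z)‖ < ε) ∧
        (∀ x, 0 < δε x r ε ∧ δε x r ε < δQ ∧
          (1 ≤ r → ∀ (n : ℕ+) (z : TaylorComplexification X), ‖z‖ ≤ δε x r ε →
            ‖φt n r ε (ofReal x + z)‖ ≤ 1 + 2 * ε))) ∧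
      (∀ x r s, 0 < s → s ≤ r → CoversAtRadius Q p s → CoversAtRadius Q p r →
        m x r ≤ m x s) ∧
      (∀ x r s, 1 ≤ r → 1 ≤ s → CoversAtRadius Q p r → CoversAtRadius Q p s →
        δ x r = δ x s ∧ a x r = a x s ∧ N x r = N x s ∧
        ∀ ε, 0 < ε → ε < 1 → δε x r ε = δε x s ε ∧ Nε x r ε = Nε x s ε) := by
  have hδQ := hQt.pos
  obtain ⟨C, hC⟩ := hQt.lipschitz
  have hQ := hQt.exists_lipschitzWith
  have hL := lipConst_nonneg Q
  obtain ⟨σ, hσ, hσ1⟩ := exists_uniform_covering_radius Q p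
  obtain ⟨m, hm, hmono⟩ := exists_first_index Q p (21 / 8) (by norm_num)
  -- The covering hypothesis sits inside the existential so that `choose` gives total functions; the
  -- default values here and below are never used on admissible data.
  have hJ : ∀ x τ, ∃ j, CoversAtRadius Q p τ → Q (x - p j) < τ := fun x τ => by
    by_cases h : CoversAtRadius Q p τ
    · obtain ⟨j, hj⟩ := h.exists_lt x
      exact ⟨j, fun _ => hj⟩
    · exact ⟨1, fun h' => absurd h' h⟩
  choose J hJ using hJ
  set M : ℕ+ → ℝ := fun n => Real.exp (2 * K ^ 2 * η) * (1 + ‖p n‖)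
  -- This is the denominator of the factorial bound with a = 1.
  set A : ℕ+ → ℝ := fun n => (Nat.factorial n : ℝ) * 1 ^ (n : ℕ) * M n
  have hM (n : ℕ+) : 0 < M n := by positivity
  have hA (n : ℕ+) : 0 < A n :=
    mul_pos (mul_pos (by exact_mod_cast Nat.factorial_pos _) (by simp)) (hM n)
  have hk : ∀ n : ℕ+, ∀ ρ ε : ℝ, ∃ k : ℝ, 0 < ρ → 0 < ε → 0 < k ∧ n * dyadicTail k n ≤ ε / 4 ∧
      2 * dyadicTail k n ≤ ε ∧ 2 * (lipConst Q / ρ) * dyadicTail k n ≤ ε ∧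
      2 * dyadicTail k n < 1 / A n := fun n ρ ε => by
    by_cases h : 0 < ρ ∧ 0 < ε
    · obtain ⟨k, hk⟩ := exists_scale (lipConst Q) hL (A n) (hA n) n h.1 h.2
      exact ⟨k, fun _ _ => hk⟩
    · exact ⟨0, fun h1 h2 => absurd ⟨h1, h2⟩ h⟩
  choose k hk using hk
  have hM1 (n : ℕ+) : 1 ≤ M n := by
    have h1 : 1 ≤ Real.exp (2 * K ^ 2 * η) := Real.one_le_exp (by positivity)
    have h2 : 1 ≤ 1 + ‖p n‖ := by linarith [norm_nonneg (p n)]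
    exact one_le_mul_of_one_le_of_one_le h1 h2
  have hAn (n : ℕ+) : (n : ℝ) ≤ A n := by
    have h1 : (n : ℝ) ≤ (Nat.factorial n : ℝ) := by exact_mod_cast Nat.self_le_factorial n
    have h2 : (0 : ℝ) ≤ (Nat.factorial n : ℝ) := Nat.cast_nonneg _
    simp only [A, one_pow, mul_one]
    nlinarith [hM1 n]
  have hAone (n : ℕ+) : 1 ≤ A n := le_trans (by exact_mod_cast n.pos) (hAn n)
  have hS : ∀ (j : ℕ+) (δ ρ ε : ℝ), ∃ δ' : ℝ, 0 < δ → 0 < ε → 0 < δ' ∧ δ' < δ ∧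
      ∀ n ≤ j, Real.exp (k n ρ ε ^ 2 * (C * δ') ^ 2) * (1 + ε) ≤ 1 + 2 * ε := fun j δ ρ ε => by
    by_cases h : 0 < δ ∧ 0 < ε
    · obtain ⟨δ', h'⟩ := exists_small_radius (fun n => k n ρ ε) C j h.1 h.2
      exact ⟨δ', fun _ _ => h'⟩
    · exact ⟨0, fun h1 h2 => absurd ⟨h1, h2⟩ h⟩
  choose S hS using hS
  -- For n > l ≥ 1/ε the bound 1/A_n ≤ 1/n already lies below ε.
  have hB : ∀ (j : ℕ+) (ε : ℝ), ∃ l : ℕ+, j ≤ l ∧ 1 / ε ≤ l := fun j ε => by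
    obtain ⟨l, hl⟩ := exists_nat_ge (1 / ε)
    refine ⟨j + l.succPNat, (PNat.lt_add_right j _).le, hl.trans ?_⟩
    push_cast
    simp only [Nat.succPNat_coe, Nat.cast_succ]
    have : (0 : ℝ) ≤ j := Nat.cast_nonneg _
    linarith
  choose B hB using hB
  set v : ℕ+ → ℝ := fun j => 1 / (16 * 2 ^ (j : ℕ))
  have hv (j : ℕ+) : 0 < v j := by positivity
  have hv' (j : ℕ+) : v j ≤ 1 / 8 := by
    have : (1 : ℝ) ≤ 2 ^ (j : ℕ) := one_le_pow₀ one_le_two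
    exact one_div_le_one_div_of_le (by norm_num) (by linarith)
  set N : X → ℝ → ℕ+ := fun x r => J x (σ r)
  -- This forces C‖z‖/r ≤ v(N), the imaginary width allowed by `norm_sepFun_le_tail`. The divisor C
  -- + 1 covers C = 0, and `min r 1` replaces r so that nothing depends on r ≥ 1.
  set δ : X → ℝ → ℝ := fun x r => min δQ (v (N x r) / (C + 1) * min r 1)
  have hδ (x : X) {r : ℝ} (hr : 0 < r) : 0 < δ x r :=
    lt_min hδQ (mul_pos (div_pos (hv _) (by positivity)) (lt_min hr one_pos))
  refine ⟨fun n r ε w => sepFun (dyadicScale (k n (min r 1) ε)) (1 + ε) n (scaledTranslates Qt p r w),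
    fun n r ε x => sepFunReal (dyadicScale (k n (min r 1) ε)) (1 + ε) n fun j => Q (x - p j) / r,
    m, N, fun _ _ => 1, δ, fun x r ε => B (N x r) ε,
    fun x r ε => S (N x r) (δ x r) (min r 1) ε, ?_, hmono, ?_⟩
  · intro r hr hcov ε hε hε1
    have hρ : 0 < min r 1 := lt_min hr one_pos
    have hk' (n : ℕ+) := hk n (min r 1) ε hρ hε
    have hk0 (n : ℕ+) : 0 ≤ k n (min r 1) ε := (hk' n).1.le
    have hT : 0 ≤ 1 + ε := by linarith
    have hoff (n : ℕ+) (x : X) (c : ℝ) (hx : x ∉ QBody Q (p n) (c * r)) : c ≤ Q (x - p n) / r := by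
      rw [le_div_iff₀ hr]
      exact not_lt.1 hx
    have hfour (n : ℕ+) (x : X) (hx : 4 ≤ Q (x - p n) / r) :
        sepFunReal (dyadicScale (k n (min r 1) ε)) (1 + ε) n (fun j => Q (x - p j) / r) ≤ ε :=
      sepFunReal_le_of_four_le (hk0 n) hε.le hε1.le (hk' n).2.2.1 hx
    have hw (x : X) (z : TaylorComplexification X) (hz : ‖z‖ < δQ) (j : ℕ+) :
        |(scaledTranslates Qt p r (ofReal x + z) j).im| ≤ C * ‖z‖ / r ∧
        |(scaledTranslates Qt p r (ofReal x + z) j).re - Q (x - p j) / r| ≤ C * ‖z‖ / r := by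
      have h := hQt.norm_scaledTranslates_sub_le hC p hr x hz j
      have him := (Complex.abs_im_le_norm _).trans h
      have hre := (Complex.abs_re_le_norm _).trans h
      rw [Complex.sub_im, Complex.ofReal_im, sub_zero] at him
      rw [Complex.sub_re, Complex.ofReal_re] at hre
      exact ⟨him, hre⟩
    have hdecay (x : X) (n : ℕ+) (z : TaylorComplexification X) (hn : N x r < n)
        (hz : ‖z‖ < δ x r) : ‖sepFun (dyadicScale (k n (min r 1) ε)) (1 + ε) n
          (scaledTranslates Qt p r (ofReal x + z))‖ < 1 / A n := by
      have hCz : C * ‖z‖ / r ≤ v (N x r) := by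
        rw [div_le_iff₀ hr]
        have h1 : ‖z‖ ≤ v (N x r) / (C + 1) * min r 1 := hz.le.trans (min_le_right _ _)
        calc C * ‖z‖ ≤ (C + 1) * (v (N x r) / (C + 1) * min r 1) :=
              mul_le_mul (by linarith) h1 (norm_nonneg _) (by positivity)
          _ = v (N x r) * min r 1 := by
              have : (C : ℝ) + 1 ≠ 0 := by positivity
              field_simp
          _ ≤ v (N x r) * r := mul_le_mul_of_nonneg_left (min_le_left _ _) (hv _).le
      have hzQ : ‖z‖ < δQ := hz.trans_le (min_le_left _ _)
      have hcenter : Q (x - p (N x r)) / r ≤ 5 / 4 := by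
        rw [div_le_iff₀ hr]
        exact (hJ x (σ r) (hσ r hr hcov).1).le.trans (hσ r hr hcov).2
      refine (norm_sepFun_le_tail (hk0 n) hε.le hε1.le hn
        (fun j => (hw x z hzQ j).1.trans hCz) ?_).trans_lt (hk' n).2.2.2.2
      linarith [(abs_le.1 (hw x z hzQ (N x r)).2).2, hv' (N x r)]
    refine ⟨fun n => hQt.differentiableOn_sepFun p r _ _ n, fun n x => ?_, fun n x => ?_,
      fun n x y => ?_, fun n x => ⟨sepFunReal_nonneg hT, sepFunReal_le hT⟩, fun x => ?_,
      fun n x hx => ⟨sepFunReal_nonneg hT, hfour n x (hoff n x 4 hx)⟩, fun n x hx => ⟨?_, ?_, ?_⟩,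
      fun x => ⟨one_pos, hδ x hr, min_le_left _ _, hdecay x⟩, fun x n z hn hz => ?_,
      fun x => ⟨?_, ?_, fun hr1 n z hz => ?_⟩⟩
    · simp only [hQt.scaledTranslates_ofReal, sepFun_ofReal]
    · exact ⟨sepFunReal_nonneg hT, (sepFunReal_le hT).trans (by linarith)⟩
    · refine (abs_sepFunReal_sub_le (fun j => dyadicScale_nonneg (hk0 n) j) hT
        (abs_scaled_sub_le hQ p hr x y) (gaussCdfReal_le_one _) (gaussCdfReal_le_one _)).trans_eq ?_
      ring
    · obtain ⟨h1, h2⟩ := hm x r hr hcov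
      refine one_lt_sepFunReal (hk0 _) hε hε1 (hk' _).2.1 (fun j hj => ?_) ?_
      · rw [le_div_iff₀ hr]
        exact h2 j hj
      · rw [div_le_iff₀ hr]
        exact h1.le
    · rw [abs_of_nonneg (sepFunReal_nonneg hT)]
      exact hfour n x (by linarith [hoff n x 5 hx])
    · exact hQt.differentiableAt_sepFunReal p r _ _ n x
    · refine (norm_fderiv_sepFunReal_le hQ p hr (hk0 n) hT n (hoff n x 5 hx)).trans
        (le_trans ?_ (hk' n).2.2.2.1)
      have := dyadicTail_pos (k n (min r 1) ε) n
      gcongr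
      exact min_le_left _ _
    · obtain ⟨h1, h2⟩ := hB (N x r) ε
      refine (hdecay x n z (h1.trans_lt hn) hz).trans_le ?_
      rw [div_le_iff₀ (hA n)]
      rw [div_le_iff₀ hε] at h2
      have h3 : ((B (N x r) ε : ℕ) : ℝ) ≤ n := by exact_mod_cast hn.le
      nlinarith [hAn n]
    · exact (hS _ _ _ _ (hδ x hr) hε).1
    · exact (hS _ _ _ _ (hδ x hr) hε).2.1.trans_le (min_le_left _ _)
    · obtain ⟨h1, h2, h3⟩ := hS (N x r) (δ x r) (min r 1) ε (hδ x hr) hε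
      -- For n up to N the radius was chosen by continuity; beyond N the decay bound 1/A_n ≤ 1 is
      -- enough.
      rcases le_or_gt n (N x r) with hn | hn
      · refine (norm_sepFun_le_exp hε.le fun j => ?_).trans (h3 n hn)
        refine (hw x z (hz.trans_lt (h2.trans_le (min_le_left _ _))) j).1.trans ?_
        rw [div_le_iff₀ hr]
        have h4 : (C : ℝ) * ‖z‖ ≤ C * S (N x r) (δ x r) (min r 1) ε :=
          mul_le_mul_of_nonneg_left hz C.2
        have h5 : 0 ≤ (C : ℝ) * S (N x r) (δ x r) (min r 1) ε := mul_nonneg C.2 h1.le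
        nlinarith
      · have h4 : 1 / A n ≤ 1 := (div_le_one (hA n)).2 (hAone n)
        linarith [hdecay x n z hn (hz.trans_lt h2)]
  · intro x r s hr hs _ _
    have hN : N x r = N x s := by simp only [N, hσ1 r s hr hs]
    have hmin : min r 1 = min s 1 := by rw [min_eq_right hr, min_eq_right hs]
    have hδ' : δ x r = δ x s := by simp only [δ, hN, hmin]
    exact ⟨hδ', rfl, hN, fun ε _ _ => by simp only [hN, hδ', hmin, and_self]⟩

/-! ### Complexification of multilinear forms. -/

namespace TaylorComplexification

variable {X : Type*} [NormedAddCommGroup X] [NormedSpace ℝ X]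

theorem norm_re_le (z : TaylorComplexification X) : ‖z.re‖ ≤ ‖z‖ := by
  simpa using le_norm z 0

theorem norm_im_le (z : TaylorComplexification X) : ‖z.im‖ ≤ ‖z‖ := by
  simpa using le_norm z (Real.pi / 2)

theorem convex_strip (δ : ℝ) : Convex ℝ (strip X δ) := by
  rintro _ ⟨x, z, hz, rfl⟩ _ ⟨y, w, hw, rfl⟩ s t hs ht hst
  refine ⟨s • x + t • y, s • z + t • w, ?_, ?_⟩
  · simpa using convex_ball (0 : TaylorComplexification X) δ (by simpa using hz)
      (by simpa using hw) hs ht hst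
  · have h := map_add (ofRealCLM X) (s • x) (t • y)
    rw [map_smul, map_smul] at h
    simp only [ofRealCLM_apply] at h
    rw [h, smul_add, smul_add]
    abel

variable {F : Type*} [NormedAddCommGroup F] [NormedSpace ℂ F]

/-- The complex linear extension of a real linear map with values in a complex space. -/
noncomputable def extendLinear (f : X →L[ℝ] F) : TaylorComplexification X →L[ℂ] F :=
  LinearMap.mkContinuous
    { toFun := fun z => f z.re + Complex.I • f z.im
      map_add' := fun z w => by
        simp only [add_re, add_im, map_add, smul_add]; abel
      map_smul' := fun c z => by
        simp only [smul_re, smul_im, map_sub, map_add, map_smul, RingHom.id_apply]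
        have h (r : ℝ) (v : F) : r • v = (r : ℂ) • v := rfl
        simp only [h]
        match_scalars
        · linear_combination Complex.re_add_im c
        · linear_combination Complex.I * Complex.re_add_im c - c.im * Complex.I_sq }
    (2 * ‖f‖) fun z => by
      have h1 := f.le_opNorm_of_le (norm_re_le z)
      have h2 := f.le_opNorm_of_le (norm_im_le z)
      refine (norm_add_le _ _).trans ?_
      rw [norm_smul, Complex.norm_I, one_mul]
      linarith

theorem extendLinear_apply (f : X →L[ℝ] F) (z : TaylorComplexification X) :
    extendLinear f z = f z.re + Complex.I • f z.im := rfl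

theorem norm_extendLinear_le (f : X →L[ℝ] F) : ‖extendLinear f‖ ≤ 2 * ‖f‖ :=
  LinearMap.mkContinuous_norm_le _ (by positivity) _

theorem extendLinear_ofReal (f : X →L[ℝ] F) (x : X) : extendLinear f (ofReal x) = f x := by
  rw [extendLinear_apply]
  simp [ofReal]

variable (X F) in
/-- `extendLinear` as a continuous linear map. -/
noncomputable def extendLinearCLM : (X →L[ℝ] F) →L[ℝ] (TaylorComplexification X →L[ℂ] F) :=
  LinearMap.mkContinuous
    { toFun := extendLinear
      map_add' := fun f g => by
        ext z
        simp only [extendLinear_apply, _root_.add_apply, smul_add]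
        abel
      map_smul' := fun c f => by
        ext z
        simp only [extendLinear_apply, _root_.smul_apply, smul_add, RingHom.id_apply]
        rw [smul_comm] } 2 norm_extendLinear_le

/-- Currying complexifies one variable at a time. The extension operator must itself be continuous
and linear, so that the induction can compose it with the map of the first variable. -/
theorem exists_multilinear_extension (k : ℕ) :
    ∃ E : (X [×k]→L[ℝ] ℂ) →L[ℝ] (TaylorComplexification X [×k]→L[ℂ] ℂ),
      ∀ A x, E A (fun i => ofReal (x i)) = A x := by
  induction k with
  | zero =>
    let e₁ := (continuousMultilinearCurryFin0 ℂ
      (TaylorComplexification X) ℂ).symm.toContinuousLinearEquiv.toContinuousLinearMap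
    let e₂ := (continuousMultilinearCurryFin0 ℝ X ℂ).toContinuousLinearEquiv.toContinuousLinearMap
    refine ⟨(e₁.restrictScalars ℝ).comp e₂, fun A x => ?_⟩
    simp only [e₁, e₂]
    simp
    congr 1
    exact Subsingleton.elim _ _
  | succ k ih =>
    obtain ⟨E, hE⟩ := ih
    let e₁ := (continuousMultilinearCurryLeftEquiv ℂ
      (fun _ : Fin (k + 1) => TaylorComplexification X)
      ℂ).symm.toContinuousLinearEquiv.toContinuousLinearMap
    let e₂ := (continuousMultilinearCurryLeftEquiv ℝ
      (fun _ : Fin (k + 1) => X) ℂ).toContinuousLinearEquiv.toContinuousLinearMap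
    refine ⟨(e₁.restrictScalars ℝ).comp
      ((extendLinearCLM X _).comp ((ContinuousLinearMap.compL ℝ X _ _ E).comp e₂)), fun A x => ?_⟩
    rw [ContinuousLinearMap.comp_apply, ContinuousLinearMap.comp_apply,
      ContinuousLinearMap.comp_apply]
    have h : ∀ f, extendLinearCLM X (TaylorComplexification X [×k]→L[ℂ] ℂ) f (ofReal (x 0)) =
        f (x 0) := fun f => extendLinear_ofReal f (x 0)
    erw [continuousMultilinearCurryLeftEquiv_symm_apply]
    rw [h]
    erw [hE]
    exact congrArg A (Fin.cons_self_tail x)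
end TaylorComplexification

/-! ### The Lipschitz holomorphic extension of Q. -/

section Extension

variable {X : Type*} [NormedAddCommGroup X] [NormedSpace ℝ X]

theorem norm_multilinear_diag_sub_le {E : Type*} [NormedAddCommGroup E] [NormedSpace ℂ E] {k : ℕ}
    (A : E [×k]→L[ℂ] ℂ) {R : ℝ} {w w' : E} (hw : ‖w‖ ≤ R) (hw' : ‖w'‖ ≤ R) :
    ‖(A fun _ => w) - A fun _ => w'‖ ≤ ‖A‖ * k * R ^ (k - 1) * ‖w - w'‖ := by
  have hR : 0 ≤ R := (norm_nonneg w).trans hw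
  refine (A.norm_image_sub_le _ _).trans ?_
  rw [Fintype.card_fin]
  have h1 : ‖fun _ : Fin k => w‖ ≤ R := (pi_norm_const_le w).trans hw
  have h2 : ‖fun _ : Fin k => w'‖ ≤ R := (pi_norm_const_le w').trans hw'
  have h3 : ‖(fun _ : Fin k => w) - fun _ => w'‖ ≤ ‖w - w'‖ := pi_norm_const_le (w - w')
  gcongr
  exact max_le h1 h2

theorem one_add_pow_le {t : ℝ} (ht : 0 ≤ t) (k : ℕ) : (1 + t) ^ k ≤ 2 ^ k * (1 + t ^ k) := by
  rw [← one_pow (M := ℝ) k]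
  rcases le_total t 1 with h | h
  · have h1 : (1 + t) ^ k ≤ 2 ^ k := pow_le_pow_left₀ (by linarith) (by linarith) k
    have h2 : (0 : ℝ) ≤ 2 ^ k * t ^ k := by positivity
    rw [one_pow]
    nlinarith
  · have h1 : (1 + t) ^ k ≤ (2 * t) ^ k := pow_le_pow_left₀ (by linarith) (by linarith) k
    have h2 : (0 : ℝ) ≤ 2 ^ k := by positivity
    rw [mul_pow] at h1
    rw [one_pow]
    nlinarith

theorem exists_lipschitz_holomorphic_extension (d : ℕ) (hd : 1 ≤ d) (q : X → ℝ)
    (hq : IsHomogeneousPolynomial (2 * d) q) (hsep : ∀ x, ‖x‖ ^ (2 * d) ≤ q x) :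
    ∃ (δ : ℝ) (Qt : TaylorComplexification X → ℂ),
      IsLipschitzHolomorphicExtension (separatingFun d q) δ Qt := by
  obtain ⟨k, hk⟩ : ∃ k, k = 2 * d := ⟨_, rfl⟩
  rw [← hk] at hq hsep
  obtain ⟨A, hA⟩ := hq
  obtain ⟨E, hE⟩ := exists_multilinear_extension (X := X) k
  have hk2 : 2 ≤ k := by omega
  have hk0 : (0 : ℝ) < k := by positivity
  set B := E (Complex.ofRealCLM.compContinuousMultilinearMap A)
  set qt : TaylorComplexification X → ℂ := fun w => B fun _ => w
  have hqt (x : X) : qt (ofReal x) = q x := by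
    simp only [qt, B]
    rw [hE, hA]
    rfl
  have hqd (w : TaylorComplexification X) : DifferentiableAt ℂ qt w := by
    have : ContDiff ℂ 1 qt := B.contDiff.comp (by fun_prop)
    exact this.differentiable one_ne_zero w
  set c : ℝ := ‖B‖ * k
  have hc : 0 ≤ c := by positivity
  -- Chosen so that (c + 1) 2^k δ = 1/2, which keeps the perturbation of q below half of 1 + ‖x‖^k.
  set δ : ℝ := 1 / (2 * (c + 1) * 2 ^ k)
  have hδ : 0 < δ := by positivity
  have hδ1 : δ ≤ 1 := by
    have : (1 : ℝ) ≤ 2 ^ k := one_le_pow₀ one_le_two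
    rw [div_le_one (by positivity)]
    nlinarith
  have hqt_sub (x : X) (z : TaylorComplexification X) (hz : ‖z‖ < δ) :
      ‖qt (ofReal x + z) - q x‖ ≤ (1 + ‖x‖ ^ k) / 2 := by
    have h1 : ‖ofReal x + z‖ ≤ 1 + ‖x‖ := by
      have := norm_add_le (ofReal x) z
      rw [norm_ofReal] at this
      linarith
    have h2 := norm_multilinear_diag_sub_le B h1
      (by rw [norm_ofReal]; linarith : ‖ofReal x‖ ≤ 1 + ‖x‖)
    rw [add_sub_cancel_left] at h2
    have h3 : (1 + ‖x‖) ^ (k - 1) ≤ (1 + ‖x‖) ^ k :=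
      pow_le_pow_right₀ (by linarith [norm_nonneg x]) (Nat.sub_le _ _)
    have h4 := one_add_pow_le (norm_nonneg x) k
    have h5 : 0 ≤ ‖x‖ ^ k := by positivity
    rw [← hqt]
    calc _ ≤ c * (1 + ‖x‖) ^ (k - 1) * ‖z‖ := h2
      _ ≤ (c + 1) * (2 ^ k * (1 + ‖x‖ ^ k)) * δ := by
          gcongr
          · linarith
          · exact h3.trans h4
      _ = (1 + ‖x‖ ^ k) / 2 := by
          simp only [δ]
          field_simp
  have hre (x : X) (z : TaylorComplexification X) (hz : ‖z‖ < δ) :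
      (1 + ‖x‖ ^ k) / 2 ≤ (1 + qt (ofReal x + z)).re := by
    have h1 := (abs_le.1 ((Complex.abs_re_le_norm _).trans (hqt_sub x z hz))).1
    rw [Complex.sub_re, Complex.ofReal_re] at h1
    rw [Complex.add_re, Complex.one_re]
    linarith [hsep x]
  have hfd (x : X) (z : TaylorComplexification X) (hz : ‖z‖ < δ) :
      ‖fderiv ℂ qt (ofReal x + z)‖ ≤ c * (2 + ‖x‖) ^ (k - 1) := by
    refine norm_fderiv_le_of_lip' ℂ (by positivity) ?_
    filter_upwards [Metric.ball_mem_nhds (ofReal x + z) one_pos] with w hw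
    have h1 : ‖ofReal x + z‖ < 1 + ‖x‖ := by
      have := norm_add_le (ofReal x) z
      rw [norm_ofReal] at this
      linarith
    have h2 := norm_le_norm_add_norm_sub' w (ofReal x + z)
    rw [mem_ball_iff_norm] at hw
    exact norm_multilinear_diag_sub_le B (by linarith) (by linarith)
  set s : ℂ := ((1 / (2 * (d : ℝ)) : ℝ) : ℂ)
  have hks : 1 / (2 * (d : ℝ)) = 1 / k := by simp [hk]
  set Qt : TaylorComplexification X → ℂ := fun w => (1 + qt w) ^ s - 1
  have hderiv (x : X) (z : TaylorComplexification X) (hz : ‖z‖ < δ) :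
      HasFDerivAt Qt ((s * (1 + qt (ofReal x + z)) ^ (s - 1)) • fderiv ℂ qt (ofReal x + z))
        (ofReal x + z) := by
    have hpos : 0 < (1 + qt (ofReal x + z)).re := lt_of_lt_of_le (by positivity) (hre x z hz)
    have h1 : HasFDerivAt (fun w => 1 + qt w) (fderiv ℂ qt (ofReal x + z)) (ofReal x + z) :=
      (hqd _).hasFDerivAt.const_add 1
    have h2 := (hasDerivAt_id (1 + qt (ofReal x + z))).cpow_const (c := s) (Or.inl hpos)
    refine HasFDerivAt.sub_const 1 ?_
    have h3 := h2.comp_hasFDerivAt (ofReal x + z) h1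
    simp only [id_eq, mul_one] at h3
    exact h3
  have hbound (x : X) (z : TaylorComplexification X) (hz : ‖z‖ < δ) :
      ‖fderiv ℂ Qt (ofReal x + z)‖ ≤ c * 8 ^ (k - 1) := by
    -- From (1 + ‖x‖)^k ≤ 2^k (1 + ‖x‖^k) and 2·2^k ≤ 4^k it follows that ρ^k ≤ (1 + ‖x‖^k)/2, the
    -- lower bound for the real part.
    set ρ := (1 + ‖x‖) / 4
    have hρ : 0 < ρ := by positivity
    have hρk : ρ ^ k ≤ ‖1 + qt (ofReal x + z)‖ := by
      refine le_trans ?_ ((hre x z hz).trans (Complex.re_le_norm _))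
      have h1 := one_add_pow_le (norm_nonneg x) k
      have h2 : (2 : ℝ) * 2 ^ k ≤ 4 ^ k := by
        have h4 : (4 : ℝ) ^ k = 2 ^ k * 2 ^ k := by rw [← mul_pow]; norm_num
        have h5 : (2 : ℝ) ^ 1 ≤ 2 ^ k := pow_le_pow_right₀ one_le_two (by omega)
        rw [h4]
        nlinarith
      rw [div_pow, div_le_div_iff₀ (by positivity) two_pos]
      have h3 : 0 ≤ 1 + ‖x‖ ^ k := by positivity
      nlinarith
    have hpow : ‖(1 + qt (ofReal x + z)) ^ (s - 1)‖ ≤ (ρ ^ (k - 1))⁻¹ := by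
      have hs1 : s - 1 = ((1 / (k : ℝ) - 1 : ℝ) : ℂ) := by
        simp only [s, hks]
        push_cast
        rfl
      have hle : 1 / (k : ℝ) - 1 ≤ 0 := by
        have : 1 / (k : ℝ) ≤ 1 := (div_le_one hk0).2 (by exact_mod_cast (by omega : 1 ≤ k))
        linarith
      rw [hs1, Complex.norm_cpow_real]
      refine (Real.rpow_le_rpow_of_nonpos (by positivity) hρk hle).trans_eq ?_
      rw [← Real.rpow_natCast, ← Real.rpow_natCast, ← Real.rpow_mul hρ.le, ← Real.rpow_neg hρ.le,
        Nat.cast_sub (by omega)]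
      congr 1
      field_simp
      simp
    have hs : ‖s‖ ≤ 1 := by
      simp only [s, hks]
      rw [Complex.norm_real, Real.norm_of_nonneg (by positivity)]
      exact (div_le_one hk0).2 (by exact_mod_cast (by omega : 1 ≤ k))
    -- Since 2 + ‖x‖ ≤ 8ρ, the growth of q̃' cancels against the negative power of ρ.
    have h8 : (2 + ‖x‖) ^ (k - 1) ≤ 8 ^ (k - 1) * ρ ^ (k - 1) := by
      rw [← mul_pow]
      refine pow_le_pow_left₀ (by positivity) ?_ _
      simp only [ρ]
      linarith [norm_nonneg x]
    rw [(hderiv x z hz).fderiv, norm_smul, norm_mul]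
    calc _ ≤ 1 * (ρ ^ (k - 1))⁻¹ * (c * (8 ^ (k - 1) * ρ ^ (k - 1))) := by
          gcongr
          exact (hfd x z hz).trans (by gcongr)
      _ = c * 8 ^ (k - 1) := by field_simp
  refine ⟨δ, Qt, hδ, fun x => ?_, ?_, ⟨(c * 8 ^ (k - 1)).toNNReal, ?_⟩⟩
  · have hq0 : 0 ≤ 1 + q x := by
      have : 0 ≤ ‖x‖ ^ k := by positivity
      linarith [hsep x]
    simp only [Qt, s, separatingFun, hqt]
    rw [Complex.ofReal_sub, Complex.ofReal_cpow hq0]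
    simp
  · rintro _ ⟨x, z, hz, rfl⟩
    exact (hderiv x z hz).differentiableAt.differentiableWithinAt
  · refine (convex_strip δ).lipschitzOnWith_of_nnnorm_fderiv_le (𝕜 := ℂ) ?_ ?_
    · rintro _ ⟨x, z, hz, rfl⟩
      exact (hderiv x z hz).differentiableAt
    · rintro _ ⟨x, z, hz, rfl⟩
      rw [← NNReal.coe_le_coe, coe_nnnorm, Real.coe_toNNReal _ (by positivity)]
      exact hbound x z hz

end Extension

end

open TaylorComplexification in
theorem mainTheorem9 {X : Type*} [NormedAddCommGroup X] [NormedSpace ℝ X] [CompleteSpace X]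
    (d : ℕ) (hd : 1 ≤ d) (q : X → ℝ) (hq : IsHomogeneousPolynomial (2 * d) q)
    (hsep : ∀ x, ‖x‖ ^ (2 * d) ≤ q x) (Q : X → ℝ) (hQ : Q = separatingFun d q) :
    -- `Q` has a Lipschitz holomorphic extension to some strip
    (∃ (δQ : ℝ) (Qt : TaylorComplexification X → ℂ), IsLipschitzHolomorphicExtension Q δQ Qt) ∧
    -- and every such strip carries the required functions
    ∀ (δQ : ℝ) (Qt : TaylorComplexification X → ℂ), IsLipschitzHolomorphicExtension Q δQ Qt →
    ∀ K η : ℝ, 0 < K → 0 < η → ∀ p : ℕ+ → X,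
    ∃ (φt : ℕ+ → ℝ → ℝ → TaylorComplexification X → ℂ) (φ : ℕ+ → ℝ → ℝ → X → ℝ)
      (m N : X → ℝ → ℕ+) (a δ : X → ℝ → ℝ) (Nε : X → ℝ → ℝ → ℕ+) (δε : X → ℝ → ℝ → ℝ),
      (∀ r : ℝ, 0 < r → CoversAtRadius Q p r → ∀ ε : ℝ, 0 < ε → ε < 1 →
        (∀ n, DifferentiableOn ℂ (φt n r ε) (strip X δQ)) ∧
        (∀ n x, φt n r ε (ofReal x) = (φ n r ε x : ℂ)) ∧
        -- values in `[0, 2]`, common Lipschitz constant `2 Lip(Q) / r`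
        (∀ n x, φ n r ε x ∈ Set.Icc (0 : ℝ) 2) ∧
        (∀ n x y, |φ n r ε x - φ n r ε y| ≤ 2 * lipConst Q / r * ‖x - y‖) ∧
        -- upper bound `1 + ε`
        (∀ n x, 0 ≤ φ n r ε x ∧ φ n r ε x ≤ 1 + ε) ∧
        -- some function exceeds `1` at each point
        (∀ x, 1 < φ (m x r) r ε x) ∧
        -- smallness off `D_Q(x_n, 4r)`
        (∀ n x, x ∉ QBody Q (p n) (4 * r) → 0 ≤ φ n r ε x ∧ φ n r ε x ≤ ε) ∧
        -- smallness, with the derivative, off `D_Q(x_n, 5r)`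
        (∀ n x, x ∉ QBody Q (p n) (5 * r) →
          |φ n r ε x| ≤ ε ∧ DifferentiableAt ℝ (φ n r ε) x ∧ ‖fderiv ℝ (φ n r ε) x‖ ≤ ε) ∧
        -- factorial decay near `x`, uniformly in `ε`
        (∀ x, 0 < a x r ∧ 0 < δ x r ∧ δ x r ≤ δQ ∧
          ∀ (n : ℕ+) (z : TaylorComplexification X), N x r < n → ‖z‖ < δ x r →
            ‖φt n r ε (ofReal x + z)‖ <
              1 / ((Nat.factorial n : ℝ) * a x r ^ (n : ℕ) *
                (Real.exp (2 * K ^ 2 * η) * (1 + ‖p n‖)))) ∧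
        -- values below `ε` near `x` for large `n`
        (∀ x (n : ℕ+) (z : TaylorComplexification X), Nε x r ε < n → ‖z‖ < δ x r →
          ‖φt n r ε (ofReal x + z)‖ < ε) ∧
        -- bound `1 + 2ε` near `x` for all `n`
        (∀ x, 0 < δε x r ε ∧ δε x r ε < δQ ∧
          (1 ≤ r → ∀ (n : ℕ+) (z : TaylorComplexification X), ‖z‖ ≤ δε x r ε →
            ‖φt n r ε (ofReal x + z)‖ ≤ 1 + 2 * ε))) ∧
      -- monotonicity of `m` in the radius
      (∀ x r s, 0 < s → s ≤ r → CoversAtRadius Q p s → CoversAtRadius Q p r →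
        m x r ≤ m x s) ∧
      -- independence of the radius as long as it is at least 1
      (∀ x r s, 1 ≤ r → 1 ≤ s → CoversAtRadius Q p r → CoversAtRadius Q p s →
        δ x r = δ x s ∧ a x r = a x s ∧ N x r = N x s ∧
        ∀ ε, 0 < ε → ε < 1 → δε x r ε = δε x s ε ∧ Nε x r ε = Nε x s ε) := by
  subst hQ
  exact ⟨exists_lipschitz_holomorphic_extension d hd q hq hsep,
    fun _ _ hQt K _ _ hη p => exists_separating_functions hQt K hη.le p⟩
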